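/- Let $p$ be an odd prime, let $R=\widehat{\mathbb Z_p^{ur}}=W(\overline{\mathbb F}_p)$ be the $p$-adic completion of the maximal unramified extension of $\mathbb Z_p$, let $k=R/pR$, let $\phi$ be the automorphism of $R$ lifting the $p$-power Frobenius, and let $U_m=1+p^mR$ for $m\ge 1$. Let $R\{x\}=R[x,x',x'',\dots]$, extend $\phi$ to a ring endomorphism of $R\{x\}$ by $\phi(x^{(i)})=(x^{(i)})^p+p\,x^{(i+1)}$, and put $\delta f=(\phi(f)-f^p)/p$, so that $\delta x^{(i)}=x^{(i+1)}$. For $f\in R[x]$ and $X=\mathrm{Spec}\,R[x]/(f)$ put $$\mathcal O^n(X)=R[x,x',\dots,x^{(n)}]^{\widehat{\ }}/(f,\delta f,\dots,\delta^n f),$$ where $\widehat{\ }$ is $p$-adic completion (this is the ring of global functions on the $p$-jet space of order $n$ of $X$). Put $\mathcal O^\infty(X)=\varinjlim_n\mathcal O^n(X)$, $\overline{\mathcal O^n(X)}=\mathcal O^n(X)\otimes_R k$ (also for $n=\infty$), and $\widetilde{\mathcal O^n(X)}=\mathrm{Im}\big(\overline{\mathcal O^n(X)}\to\overline{\mathcal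 O^\infty(X)}\big)$. For $a\in R^\times$ let $\mu^a_{p^\nu}=\mathrm{Spec}\,R[x]/(x^{p^\nu}-a)$ and $\mu_{p^\nu}=\mu^1_{p^\nu}$. **Theorem.** Let $n,\nu\ge 1$ and $a\in U_1$. 1) If $a\notin U_{\nu+1}$, then $\widetilde{\mathcal O^n(\mu^a_{p^\nu})}=0$. 2) If $a\in U_{\nu+1}$, then there are isomorphisms of $k$-algebras $$\widetilde{\mathcal O^n(\mu^a_{p^\nu})}\simeq\widetilde{\mathcal O^n(\mu_{p^\nu})}\simeq\frac{k[x,x',\dots,x^{(n)}]}{\big((x-1)^{p^\nu},(x')^{p^\nu},\dots,(x^{(n)})^{p^\nu}\big)},$$ $$\overline{\mathcal O^n(\mu^a_{p^\nu})}\simeq\overline{\mathcal O^n(\mu_{p^\nu})}\simeq\frac{k[x,x',\dots,x^{(n)}]}{(x^{p^\nu}-1)}\quad\text{if } n\le\nu,$$ $$\overline{\mathcal O^n(\mu^a_{p^\nu})}\simeq\overline{\mathcal O^n(\mu_{p^\nu})}\simeq\frac{k[x,x',\dots,x^{(n)}]}{\big(x^{p^\nu}-1,(x')^{p^\nu},\dots,(x^{(n-\nu)})^{p^\nu}\big)}\quad\text{if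 } n\ge\nu+1.$$ -/

import Mathlib

open scoped TensorProduct

noncomputable section

namespace PJet

/-! ## The base ring and its residue field -/

section Base

variable (p : ℕ) [Fact p.Prime]

/-- The `p`-adic completion of the maximal unramified extension of `ℤ_p`, i.e. the ring
`W(𝔽̄_p)` of `p`-typical Witt vectors over an algebraic closure of `𝔽_p`. -/
abbrev UnrRing : Type := WittVector p (AlgebraicClosure (ZMod p))

/-- The residue field `k = R / pR`. -/
abbrev ResField : Type := UnrRing p ⧸ Ideal.span {(p : UnrRing p)}

/-- The set `U_m = 1 + p ^ m R`. -/
def principalUnits (m : ℕ) : Set (UnrRing p) :=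
  {a | ∃ b : UnrRing p, a = 1 + (p : UnrRing p) ^ m * b}

/-! ## The ring of `δ`-polynomials in one variable -/

/-- The underlying ring of `R{x} = R[x, x', x'', …]`: the variable with index `i`
is `x^{(i)}`. -/
abbrev DeltaPoly : Type := MvPolynomial ℕ (UnrRing p)

/-- The lift of Frobenius `φ` on `R{x}`: it is the Frobenius automorphism on `R`, and
`φ (x^{(i)}) = (x^{(i)}) ^ p + p x^{(i+1)}`. -/
def phi : DeltaPoly p →+* DeltaPoly p :=
  MvPolynomial.eval₂Hom
    (MvPolynomial.C.comp (WittVector.frobenius : UnrRing p →+* UnrRing p))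
    (fun i => MvPolynomial.X i ^ p + (p : DeltaPoly p) * MvPolynomial.X (i + 1))

theorem exists_frobenius_eq (r : UnrRing p) :
    ∃ s : UnrRing p, WittVector.frobenius r = r ^ p + (p : UnrRing p) * s := by
  have h : (WittVector.frobenius r - r ^ p : UnrRing p) ∈ Ideal.span {(p : UnrRing p)} := by
    rw [← WittVector.ker_constantCoeff, RingHom.mem_ker, map_sub, map_pow]
    simp [WittVector.constantCoeff, WittVector.coeff_frobenius_charP]
  obtain ⟨s, hs⟩ := Ideal.mem_span_singleton'.1 h
  exact ⟨s, by rw [mul_comm, hs]; ring⟩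

theorem exists_phi_eq (f : DeltaPoly p) :
    ∃ g : DeltaPoly p, phi p f = f ^ p + (p : DeltaPoly p) * g := by
  induction f using MvPolynomial.induction_on with
  | C r =>
    obtain ⟨s, hs⟩ := exists_frobenius_eq p r
    refine ⟨MvPolynomial.C s, ?_⟩
    simp [phi, hs]
  | add f g hf hg =>
    obtain ⟨u, hu⟩ := hf
    obtain ⟨v, hv⟩ := hg
    obtain ⟨r, hr⟩ := exists_add_pow_prime_eq (Fact.out : p.Prime) f g
    refine ⟨u + v - f * g * r, ?_⟩
    rw [map_add, hu, hv, hr]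
    ring
  | mul_X f i hf =>
    obtain ⟨u, hu⟩ := hf
    refine ⟨MvPolynomial.X i ^ p * u + f ^ p * MvPolynomial.X (i + 1)
      + (p : DeltaPoly p) * u * MvPolynomial.X (i + 1), ?_⟩
    have hX : phi p (MvPolynomial.X i)
        = MvPolynomial.X i ^ p + (p : DeltaPoly p) * MvPolynomial.X (i + 1) := by
      simp [phi]
    rw [map_mul, hu, hX]
    ring

/-- The `p`-derivation `δ f = (φ f - f ^ p) / p` of `R{x}`; it extends the `p`-derivation
of `R`, and `δ (x^{(i)}) = x^{(i+1)}`. The quotient is unique because `R{x}` has no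
`p`-torsion. -/
def delta (f : DeltaPoly p) : DeltaPoly p := (exists_phi_eq p f).choose

theorem phi_eq (f : DeltaPoly p) : phi p f = f ^ p + (p : DeltaPoly p) * delta p f :=
  (exists_phi_eq p f).choose_spec

/-! ## `p`-adic completion of algebras -/

/-- The `p`-adic completion of a ring. -/
abbrev PCompletion (A : Type) [CommRing A] : Type := AdicCompletion (Ideal.span {(p : A)}) A

section Functoriality

variable {A B : Type} [CommRing A] [CommRing B] [Algebra (UnrRing p) A] [Algebra (UnrRing p) B]

theorem span_pow_le_comap (f : A →ₐ[UnrRing p] B) (n : ℕ) :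
    Ideal.span {(p : A)} ^ n ≤ (Ideal.span {(p : B)} ^ n).comap f := by
  rw [← Ideal.map_le_iff_le_comap, Ideal.map_pow, Ideal.map_span, Set.image_singleton,
    map_natCast]

/-- The map induced by `f : A → B` on the quotients by `p ^ n`, precomposed with the
projection from the completion of `A`. -/
def completionMapAux (f : A →ₐ[UnrRing p] B) (n : ℕ) :
    PCompletion p A →ₐ[UnrRing p] B ⧸ Ideal.span {(p : B)} ^ n :=
  (Ideal.quotientMapₐ (Ideal.span {(p : B)} ^ n) f (span_pow_le_comap p f n)).comp
    ((AdicCompletion.evalₐ (Ideal.span {(p : A)}) n).restrictScalars (UnrRing p))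

theorem completionMapAux_compat (f : A →ₐ[UnrRing p] B) {m n : ℕ} (hle : m ≤ n) :
    (Ideal.Quotient.factorₐ (UnrRing p) (Ideal.pow_le_pow_right hle)).comp
      (completionMapAux p f n) = completionMapAux p f m := by
  ext x
  obtain ⟨x, rfl⟩ := AdicCompletion.mk_surjective _ _ x
  simp only [completionMapAux, AlgHom.comp_apply, AlgHom.restrictScalars_apply,
    AdicCompletion.evalₐ_mk]
  change Ideal.Quotient.mk (Ideal.span {(p : B)} ^ m) (f (x.val n))
    = Ideal.Quotient.mk (Ideal.span {(p : B)} ^ m) (f (x.val m))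
  have h := AdicCompletion.Ideal.mk_eq_mk (Ideal.span {(p : A)}) hle x
  rw [Ideal.Quotient.eq] at h ⊢
  rw [← map_sub]
  exact span_pow_le_comap p f m h

/-- The map induced by an `R`-algebra map on `p`-adic completions. -/
def completionMap (f : A →ₐ[UnrRing p] B) :
    PCompletion p A →ₐ[UnrRing p] PCompletion p B :=
  AdicCompletion.liftAlgHom _ (completionMapAux p f) (completionMapAux_compat p f)

theorem evalₐ_completionMap (f : A →ₐ[UnrRing p] B) (n : ℕ) (x : PCompletion p A) :
    AdicCompletion.evalₐ (Ideal.span {(p : B)}) n (completionMap p f x)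
      = completionMapAux p f n x := by
  rw [completionMap, AdicCompletion.evalₐ_liftAlgHom]

theorem completionMap_of (f : A →ₐ[UnrRing p] B) (x : A) :
    completionMap p f (AdicCompletion.of _ A x) = AdicCompletion.of _ B (f x) := by
  refine AdicCompletion.ext_evalₐ fun n => ?_
  rw [evalₐ_completionMap]
  simp [completionMapAux]

theorem completionMap_id (x : PCompletion p A) :
    completionMap p (AlgHom.id (UnrRing p) A) x = x := by
  refine AdicCompletion.ext_evalₐ fun n => ?_
  rw [evalₐ_completionMap]
  obtain ⟨x, rfl⟩ := AdicCompletion.mk_surjective _ _ x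
  simp [completionMapAux]

theorem completionMap_comp {C : Type} [CommRing C] [Algebra (UnrRing p) C]
    (g : B →ₐ[UnrRing p] C) (f : A →ₐ[UnrRing p] B) (x : PCompletion p A) :
    completionMap p g (completionMap p f x) = completionMap p (g.comp f) x := by
  refine AdicCompletion.ext_evalₐ fun n => ?_
  have h := evalₐ_completionMap p f n x
  rw [evalₐ_completionMap, evalₐ_completionMap]
  simp only [completionMapAux, AlgHom.comp_apply, AlgHom.restrictScalars_apply] at h ⊢
  rw [h]
  obtain ⟨x, rfl⟩ := AdicCompletion.mk_surjective _ _ x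
  simp

end Functoriality

/-! ## The `p`-jet spaces of a closed subscheme of the affine line

For `X = Spec R[x]/(f)` the ring of global functions on the `p`-jet space `J^n(X)` is
`𝒪^n(X) = R[x, x', …, x^{(n)}]^ / (f, δ f, …, δ^n f)`. -/

/-- The ring `R[x, x', …, x^{(n)}]`. -/
abbrev JetPoly (n : ℕ) : Type := MvPolynomial (Fin (n + 1)) (UnrRing p)

/-- The inclusion of `R[x, x', …, x^{(n)}]` in `R{x}`. -/
def jetIncl (n : ℕ) : JetPoly p n →ₐ[UnrRing p] DeltaPoly p :=
  MvPolynomial.rename (fun i : Fin (n + 1) => (i : ℕ))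

/-- A polynomial `f ∈ R[x]` viewed in `R{x}`. -/
def toDelta (f : Polynomial (UnrRing p)) : DeltaPoly p :=
  Polynomial.aeval (MvPolynomial.X 0) f

/-- The elements `f, δ f, …, δ^n f` of `R[x, x', …, x^{(n)}]`. -/
def jetGens (f : Polynomial (UnrRing p)) (n : ℕ) : Set (JetPoly p n) :=
  {g | ∃ i ≤ n, jetIncl p n g = (delta p)^[i] (toDelta p f)}

/-- The ideal of `R[x, x', …, x^{(n)}]^` generated by `f, δ f, …, δ^n f`. -/
def jetIdeal (f : Polynomial (UnrRing p)) (n : ℕ) : Ideal (PCompletion p (JetPoly p n)) :=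
  Ideal.span (AdicCompletion.of (Ideal.span {(p : JetPoly p n)}) (JetPoly p n) '' jetGens p f n)

/-- The ring `𝒪^n(X)` for `X = Spec R[x]/(f)`. -/
abbrev JetRing (f : Polynomial (UnrRing p)) (n : ℕ) : Type :=
  PCompletion p (JetPoly p n) ⧸ jetIdeal p f n

/-- The inclusion `R[x, x', …, x^{(m)}] → R[x, x', …, x^{(n)}]` for `m ≤ n`. -/
def jetPolyMap {m n : ℕ} (h : m ≤ n) : JetPoly p m →ₐ[UnrRing p] JetPoly p n :=
  MvPolynomial.rename (Fin.castLE (Nat.succ_le_succ h))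

theorem jetIncl_jetPolyMap {m n : ℕ} (h : m ≤ n) (g : JetPoly p m) :
    jetIncl p n (jetPolyMap p h g) = jetIncl p m g := by
  rw [jetIncl, jetPolyMap, MvPolynomial.rename_rename]
  rfl

theorem jetIdeal_le_comap (f : Polynomial (UnrRing p)) {m n : ℕ} (h : m ≤ n) :
    jetIdeal p f m ≤ (jetIdeal p f n).comap (completionMap p (jetPolyMap p h)) := by
  refine Ideal.span_le.2 ?_
  rintro _ ⟨g, ⟨i, hi, hg⟩, rfl⟩
  change completionMap p (jetPolyMap p h) _ ∈ jetIdeal p f n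
  rw [completionMap_of]
  exact Ideal.subset_span ⟨_, ⟨i, hi.trans h, (jetIncl_jetPolyMap p h g).trans hg⟩, rfl⟩

/-- The transition map `𝒪^m(X) → 𝒪^n(X)` for `m ≤ n`. -/
def jetMap (f : Polynomial (UnrRing p)) (m n : ℕ) (h : m ≤ n) :
    JetRing p f m →ₐ[UnrRing p] JetRing p f n :=
  Ideal.quotientMapₐ (jetIdeal p f n) (completionMap p (jetPolyMap p h))
    (jetIdeal_le_comap p f h)

instance jetDirectedSystem (f : Polynomial (UnrRing p)) :
    DirectedSystem (JetRing p f) (fun m n h => jetMap p f m n h) where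
  map_self n x := by
    obtain ⟨x, rfl⟩ := Ideal.Quotient.mk_surjective x
    change Ideal.Quotient.mk _ (completionMap p (jetPolyMap p le_rfl) x) = _
    have h : jetPolyMap p (le_refl n) = AlgHom.id _ _ := by
      ext i
      simp [jetPolyMap]
    rw [h, completionMap_id]
  map_map l m n hnm hml x := by
    obtain ⟨x, rfl⟩ := Ideal.Quotient.mk_surjective x
    change Ideal.Quotient.mk _ (completionMap p (jetPolyMap p hml)
      (completionMap p (jetPolyMap p hnm) x)) =
      Ideal.Quotient.mk _ (completionMap p (jetPolyMap p (hnm.trans hml)) x)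
    have h : (jetPolyMap p hml).comp (jetPolyMap p hnm) = jetPolyMap p (hnm.trans hml) := by
      ext i
      simp [jetPolyMap]
    rw [completionMap_comp, h]

/-- The ring `𝒪^∞(X)`, the direct limit of the rings `𝒪^n(X)`. -/
abbrev JetRingInf (f : Polynomial (UnrRing p)) : Type :=
  DirectLimit (JetRing p f) (jetMap p f)

/-- The canonical map `𝒪^n(X) → 𝒪^∞(X)`. -/
def jetToInf (f : Polynomial (UnrRing p)) (n : ℕ) :
    JetRing p f n →ₐ[UnrRing p] JetRingInf p f where
  toFun x := ⟦⟨n, x⟩⟧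
  map_one' := (DirectLimit.one_def n).symm
  map_mul' x y := (DirectLimit.mul_def n x y).symm
  map_zero' := (DirectLimit.zero_def n).symm
  map_add' x y := (DirectLimit.add_def n x y).symm
  commutes' r := (DirectLimit.algebraMap_def n r).symm

/-- The reduction mod `p` of `𝒪^n(X)`, the `k`-algebra `k ⊗_R 𝒪^n(X)`. -/
abbrev JetBar (f : Polynomial (UnrRing p)) (n : ℕ) : Type :=
  ResField p ⊗[UnrRing p] JetRing p f n

/-- The reduction mod `p` of `𝒪^∞(X)`. -/
abbrev JetBarInf (f : Polynomial (UnrRing p)) : Type :=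
  ResField p ⊗[UnrRing p] JetRingInf p f

/-- The image of the reduction of `𝒪^n(X)` in the reduction of `𝒪^∞(X)`. -/
def jetTilde (f : Polynomial (UnrRing p)) (n : ℕ) : Subalgebra (ResField p) (JetBarInf p f) :=
  (Algebra.TensorProduct.map (AlgHom.id (ResField p) (ResField p)) (jetToInf p f n)).range

/-! ## The schemes `μ^a_{p^ν}` -/

/-- The polynomial `x ^ (p ^ ν) - a`, so that `μ^a_{p^ν} = Spec R[x]/(x ^ (p ^ ν) - a)`. -/
def muPoly (ν : ℕ) (a : UnrRing p) : Polynomial (UnrRing p) :=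
  Polynomial.X ^ p ^ ν - Polynomial.C a

/-! ## The explicit `k`-algebras -/

/-- `k[x, x', …, x^{(n)}] / ((x - 1)^{p^ν}, (x')^{p^ν}, …, (x^{(n)})^{p^ν})`. -/
abbrev TildeModel (n ν : ℕ) : Type :=
  MvPolynomial (Fin (n + 1)) (ResField p) ⧸
    Ideal.span ({(MvPolynomial.X 0 - 1) ^ p ^ ν} ∪
      {g : MvPolynomial (Fin (n + 1)) (ResField p) |
        ∃ i : Fin (n + 1), 1 ≤ (i : ℕ) ∧ g = MvPolynomial.X i ^ p ^ ν})

/-- `k[x, x', …, x^{(n)}] / (x^{p^ν} - 1, (x')^{p^ν}, …, (x^{(r)})^{p^ν})`, for `r ≤ n`. For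
`r = 0` this is `k[x, x', …, x^{(n)}] / (x^{p^ν} - 1)`. -/
abbrev BarModel (n ν r : ℕ) : Type :=
  MvPolynomial (Fin (n + 1)) (ResField p) ⧸
    Ideal.span ({MvPolynomial.X 0 ^ p ^ ν - 1} ∪
      {g : MvPolynomial (Fin (n + 1)) (ResField p) |
        ∃ i : Fin (n + 1), 1 ≤ (i : ℕ) ∧ (i : ℕ) ≤ r ∧ g = MvPolynomial.X i ^ p ^ ν})

end Base

end PJet

end

/-! Points of `p`-jet spaces in a `k`-algebra `B` are Witt vectors. A sequence of values of `x, x',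
x'', …` in `B` is the family of constant components `jetCoord w` of `w, δ w, δ² w, …` for a `w` in
`W(B)`, and it is a jet point of order `n` of `x^(p^ν) = a` exactly when `w^(p^ν)` and `a` have the
same Witt components up to index `n` (`wittEval_delta`, `isJetPoint_muPoly_iff_coeff`).

For odd `p`, iterating the binomial theorem gives `w^(p^ν) = [w₀^(p^ν)] + p^ν V(t)` with `t =
powTail ν w` (`pow_prime_pow_eq`). In characteristic `p`, multiplication by `p^ν` shifts components
by `ν` and raises them to the power `p^ν`. So the components of `w^(p^ν)` at the indices `1, …, ν`
vanish, and the one at `i + ν + 1` is `t_i^(p^ν)`. The first fact forces `a ∈ U_(ν+1)` as soon as a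
nonzero ring carries a point of order `ν`.

For such `a`, choose `γ_i` in the algebraically closed field with `γ_i^(p^ν) = a_(i+ν+1)`, and put
`z_0 = w_0`, `z_(i+1) = t_i - γ_i`. The equations become `z_0^(p^ν) = 1` and `z_(i+1)^(p^ν) = 0` for
`i + ν + 1 ≤ n`, with no trace of `a` (`JetCorr.isJetPoint_iff`). Both the jet coordinates and the
`z_i` are triangular in the components of `w`, with unit slopes when `w_0` is a unit, so each family
up to index `n` determines the other. Applied to the universal points, this yields the isomorphisms
with the explicit algebras. In the limit over all orders, each `z_(i+1)` satisfies its equation,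
which explains the image in the limit. -/

namespace WittVector

/-! ### Truncations, Teichmüller representatives and Verschiebung. -/

section Truncation

variable {p : ℕ} [hp : Fact p.Prime] {B B' : Type*} [CommRing B] [CommRing B']

theorem truncate_eq_iff {n : ℕ} {x y : WittVector p B} :
    truncate n x = truncate n y ↔ ∀ i < n, x.coeff i = y.coeff i := by
  rw [le_coeff_eq_iff_le_sub_coeff_eq_zero, ← mem_ker_truncate, RingHom.mem_ker, map_sub,
    sub_eq_zero]

theorem truncate_eq_of_le {m n : ℕ} (h : m ≤ n) {x y : WittVector p B}
    (hxy : truncate n x = truncate n y) : truncate m x = truncate m y :=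
  truncate_eq_iff.2 fun i hi => truncate_eq_iff.1 hxy i (hi.trans_le h)

theorem truncate_succ_verschiebung {n : ℕ} {x y : WittVector p B}
    (hxy : truncate n x = truncate n y) :
    truncate (n + 1) (verschiebung x) = truncate (n + 1) (verschiebung y) := by
  rw [truncate_eq_iff] at *
  rintro (_ | i) hi
  · simp
  · exact hxy i (by omega)

theorem truncate_shift_one {n : ℕ} {x y : WittVector p B}
    (hxy : truncate (n + 1) x = truncate (n + 1) y) :
    truncate n (x.shift 1) = truncate n (y.shift 1) := by
  rw [truncate_eq_iff] at *
  intro i hi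
  exact hxy (1 + i) (by omega)

/-- Split `y` into its components below `n`, which are disjoint from the rest, and a vector `V^n s`.
Since `V` is additive, only the constant components of `s` and `t` get added at index `n`. -/
theorem coeff_add_iterate_verschiebung (y t : WittVector p B) (n : ℕ) :
    (y + verschiebung^[n] t).coeff n = y.coeff n + t.coeff 0 := by
  have h : ∀ i < n, (tail n y).coeff i = 0 := fun i hi => by
    simp [tail, select, coeff_mk, Nat.not_le.2 hi]
  have h0 : (shift (tail n y) n).coeff 0 = y.coeff n := by
    simp [shift_coeff, tail, select, coeff_mk]
  have hc : ∀ x : WittVector p B, (verschiebung^[n] x).coeff n = x.coeff 0 := fun x => by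
    simpa using iterate_verschiebung_coeff x n 0
  conv_lhs => rw [← init_add_tail y n, eq_iterate_verschiebung h, add_assoc,
    ← iterate_map_add verschiebung]
  rw [coeff_add_of_disjoint]
  · rw [hc, add_coeff_zero, h0]
    simp [init, select, coeff_mk]
  · intro i
    by_cases hi : i < n
    · exact Or.inr (iterate_verschiebung_coeff_eq_zero _ hi)
    · exact Or.inl (by simp [init, select, coeff_mk, hi])

/-- Changing two summands only from index `n`, resp. `n + 1`, on changes the `n`-th coefficient
of the sum by as much as that of the first summand. -/
theorem coeff_add_sub_coeff {n : ℕ} {x x' y y' : WittVector p B}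
    (hx : truncate n x = truncate n x') (hy : truncate (n + 1) y = truncate (n + 1) y') :
    (x + y).coeff n - x.coeff n = (x' + y').coeff n - x'.coeff n := by
  have h : ∀ i < n, (x - x').coeff i = 0 :=
    le_coeff_eq_iff_le_sub_coeff_eq_zero.1 (truncate_eq_iff.1 hx)
  obtain ⟨t, ht⟩ : ∃ t, x = x' + verschiebung^[n] t :=
    ⟨_, by rw [← eq_iterate_verschiebung h]; ring⟩
  have hs : (x' + y).coeff n = (x' + y').coeff n :=
    truncate_eq_iff.1 (show truncate (n + 1) _ = truncate (n + 1) _ by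
      rw [map_add, map_add, hy]) n n.lt_succ_self
  rw [ht, add_right_comm, coeff_add_iterate_verschiebung, coeff_add_iterate_verschiebung, hs]
  ring

theorem coeff_sub_sub_coeff {n : ℕ} {x x' y y' : WittVector p B}
    (hx : truncate n x = truncate n x') (hy : truncate (n + 1) y = truncate (n + 1) y') :
    (x - y).coeff n - x.coeff n = (x' - y').coeff n - x'.coeff n := by
  have h := coeff_add_sub_coeff (y := -y) (y' := -y') hx (by rw [map_neg, map_neg, hy])
  simpa only [← sub_eq_add_neg] using h

theorem teichmuller_add_verschiebung_coeff_zero (c : B) (t : WittVector p B) :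
    (teichmuller p c + verschiebung t).coeff 0 = c := by
  rw [add_coeff_zero, teichmuller_coeff_zero, verschiebung_coeff_zero, add_zero]

theorem teichmuller_add_verschiebung_coeff_succ (c : B) (t : WittVector p B) (n : ℕ) :
    (teichmuller p c + verschiebung t).coeff (n + 1) = t.coeff n := by
  rw [coeff_add_of_disjoint, teichmuller_coeff_pos _ _ _ n.succ_pos, zero_add,
    verschiebung_coeff_succ]
  rintro (_ | i)
  · exact Or.inr (verschiebung_coeff_zero _)
  · exact Or.inl (teichmuller_coeff_pos _ _ _ i.succ_pos)

theorem eq_teichmuller_add_verschiebung (x : WittVector p B) :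
    x = teichmuller p (x.coeff 0) + verschiebung (x.shift 1) := by
  ext (_ | n)
  · rw [teichmuller_add_verschiebung_coeff_zero]
  · rw [teichmuller_add_verschiebung_coeff_succ, shift_coeff, add_comm]

theorem natCast_mul_verschiebung (m : ℕ) (x : WittVector p B) :
    (m : WittVector p B) * verschiebung x = verschiebung ((m : WittVector p B) * x) := by
  rw [← nsmul_eq_mul, ← nsmul_eq_mul, map_nsmul]

theorem verschiebung_mul_verschiebung (x y : WittVector p B) :
    verschiebung x * verschiebung y = (p : WittVector p B) * verschiebung (x * y) := by
  rw [← verschiebung_mul_frobenius, frobenius_verschiebung, natCast_mul_verschiebung]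
  congr 1
  ring

theorem verschiebung_pow_succ (x : WittVector p B) (m : ℕ) :
    verschiebung x ^ (m + 1) = (p : WittVector p B) ^ m * verschiebung (x ^ (m + 1)) := by
  induction m with
  | zero => simp
  | succ m ih =>
    rw [pow_succ, ih, mul_assoc, verschiebung_mul_verschiebung, ← pow_succ]
    ring

theorem map_shift (f : B →+* B') (x : WittVector p B) (n : ℕ) :
    map f (x.shift n) = (map f x).shift n := rfl

variable [CharP B p]

theorem frobenius_teichmuller (c : B) : frobenius (teichmuller p c) = teichmuller p (c ^ p) := by
  ext (_ | n)
  · rw [coeff_frobenius_charP, teichmuller_coeff_zero, teichmuller_coeff_zero]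
  · rw [coeff_frobenius_charP, teichmuller_coeff_pos _ _ _ n.succ_pos,
      teichmuller_coeff_pos _ _ _ n.succ_pos, zero_pow hp.out.ne_zero]

theorem verschiebung_mul_teichmuller (x : WittVector p B) (c : B) :
    verschiebung x * teichmuller p c = verschiebung (x * teichmuller p (c ^ p)) := by
  rw [← frobenius_teichmuller, verschiebung_mul_frobenius]

theorem coeff_teichmuller_mul (c : B) (x : WittVector p B) (n : ℕ) :
    (teichmuller p c * x).coeff n = c ^ p ^ n * x.coeff n := by
  induction n generalizing c x with
  | zero => simp [mul_coeff_zero]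
  | succ n ih =>
    conv_lhs => rw [eq_teichmuller_add_verschiebung x, mul_add, ← map_mul,
      mul_comm _ (verschiebung _),
      verschiebung_mul_teichmuller, mul_comm _ (teichmuller p _)]
    rw [teichmuller_add_verschiebung_coeff_succ, ih, shift_coeff, ← pow_mul,
      ← pow_succ', add_comm 1]

theorem map_frobenius [CharP B' p] (f : B →+* B') (x : WittVector p B) :
    map f (frobenius x) = frobenius (map f x) := by
  ext n
  simp

/-! ### The `p`-th power of `[y] + p^ν V ζ`. -/

/-- The integers by which the binomial expansion of `([y] + p ^ ν V ζ) ^ p` departs from its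
linear part. -/
def powStepCoeff (p ν j : ℕ) : ℕ := p.choose j * p ^ (ν * j + (j - 1)) / p ^ (ν + 2)

/-- The division defining `powStepCoeff` is exact. For `2 ≤ j < p` the binomial coefficient supplies
one factor `p`; for `j = p` the exponent `ν p + p - 1` is already at least `ν + 2`. The latter fails
for `p = 2`, `ν = 0`. -/
theorem pow_mul_powStepCoeff (h2 : p ≠ 2) (ν : ℕ) {i : ℕ} (hi : i < p - 1) :
    p ^ (ν + 2) * powStepCoeff p ν (i + 2) = p.choose (i + 2) * p ^ (ν * (i + 2) + (i + 1)) := by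
  refine Nat.mul_div_cancel' ?_
  have h1 : ν ≤ ν * (i + 2) := Nat.le_mul_of_pos_right _ (by omega)
  have h3 := hp.out.two_le
  by_cases h : i + 2 < p
  · rw [pow_succ', show i + 2 - 1 = i + 1 from rfl]
    exact mul_dvd_mul (hp.out.dvd_choose_self (by omega) h) (pow_dvd_pow _ (by omega))
  · exact (pow_dvd_pow _ (by omega)).mul_left _

/-- The Witt vector with `([y] + p ^ ν V ζ) ^ p = [y] ^ p + p ^ (ν + 1) V (powStep ν y ζ)`. -/
noncomputable def powStep (ν : ℕ) (y : B) (ζ : WittVector p B) : WittVector p B :=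
  teichmuller p (y ^ (p * (p - 1))) * ζ + p * ∑ i ∈ Finset.range (p - 1),
    (powStepCoeff p ν (i + 2) : WittVector p B) *
      (ζ ^ (i + 2) * teichmuller p (y ^ (p * (p - (i + 2)))))

/-- Binomial expansion: `(V ζ)^j = p^(j-1) V(ζ^j)`, and Teichmüller factors move inside `V` as
`p`-th powers. Terms of degree at least 2 are divisible by `p^(ν+2)`, one power of `p` more than the
linear term, so in `powStep` they all carry a factor `p`. -/
theorem teichmuller_add_pow (h2 : p ≠ 2) (ν : ℕ) (y : B) (ζ : WittVector p B) :
    (teichmuller p y + (p : WittVector p B) ^ ν * verschiebung ζ) ^ p =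
      teichmuller p (y ^ p) + (p : WittVector p B) ^ (ν + 1) * verschiebung (powStep ν y ζ) := by
  have key : ∀ i ∈ Finset.range (p - 1),
      ((p : WittVector p B) ^ ν * verschiebung ζ) ^ (i + 2) * teichmuller p y ^ (p - (i + 2)) *
        (p.choose (i + 2) : WittVector p B) = (p : WittVector p B) ^ (ν + 1) *
        (p * ((powStepCoeff p ν (i + 2) : WittVector p B) *
        verschiebung (ζ ^ (i + 2) * teichmuller p (y ^ (p * (p - (i + 2))))))) := by
    intro i hi
    have h := congrArg (Nat.cast : ℕ → WittVector p B)
      (pow_mul_powStepCoeff h2 ν (Finset.mem_range.1 hi))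
    push_cast at h
    rw [mul_pow, verschiebung_pow_succ, ← map_pow, mul_comm p, pow_mul,
      ← verschiebung_mul_teichmuller]
    linear_combination -(verschiebung (ζ ^ (i + 2)) * teichmuller p (y ^ (p - (i + 2)))) * h
  have hl : verschiebung (ζ * teichmuller p (y ^ (p * (p - 1)))) =
      verschiebung ζ * teichmuller p y ^ (p - 1) := by
    rw [← map_pow, verschiebung_mul_teichmuller, ← pow_mul, mul_comm p]
  rw [add_comm, add_pow]
  rw [show Finset.range (p + 1) = Finset.range (p - 1 + 1 + 1) by
    congr 2; have := hp.out.two_le; omega, Finset.sum_range_succ', Finset.sum_range_succ']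
  simp only [add_assoc, one_add_one_eq_two]
  rw [Finset.sum_congr rfl key, powStep, map_add, ← natCast_mul_verschiebung, map_sum,
    mul_comm (teichmuller p _) ζ, hl, ← Finset.mul_sum, ← Finset.mul_sum]
  simp only [← natCast_mul_verschiebung]
  simp only [zero_add, pow_one, pow_zero, Nat.choose_one_right, Nat.choose_zero_right,
    Nat.cast_one, Nat.sub_zero, map_pow]
  ring

end Truncation

/-! ### Triangular coordinate systems on Witt vectors. -/

section Coordinates

/-- The leading coefficient of the `n`-th component of `powTail ν w`, as a polynomial in the
`(n + 1)`-st component of `w`. -/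
def powTailLead {B : Type*} [CommRing B] (p : ℕ) (x : B) (n : ℕ) : ℕ → B
  | 0 => 1
  | ν + 1 => ((x ^ p ^ ν) ^ (p * (p - 1))) ^ p ^ n * powTailLead p x n ν

theorem isUnit_powTailLead {B : Type*} [CommRing B] (p : ℕ) {x : B} (hx : IsUnit x) (n ν : ℕ) :
    IsUnit (powTailLead p x n ν) := by
  induction ν with
  | zero => exact isUnit_one
  | succ ν ih => exact (((hx.pow _).pow _).pow _).mul ih

variable {p : ℕ} [hp : Fact p.Prime] {B B' : Type*} [CommRing B] [CommRing B']

theorem map_powStep (f : B →+* B') (ν : ℕ) (y : B) (ζ : WittVector p B) :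
    map f (powStep ν y ζ) = powStep ν (f y) (map f ζ) := by
  simp only [powStep, map_add, map_mul, map_sum, map_pow, map_natCast, map_teichmuller]

theorem truncate_powStep {n : ℕ} {ζ ζ' : WittVector p B} (h : truncate n ζ = truncate n ζ')
    (ν : ℕ) (y : B) : truncate n (powStep ν y ζ) = truncate n (powStep ν y ζ') := by
  simp only [powStep, map_add, map_mul, map_sum, map_pow, h]

/-- The `p`-derivation of the ring of Witt vectors of a ring of characteristic `p`. -/
noncomputable def pDeriv (v : WittVector p B) : WittVector p B :=
  v.shift 1 - verschiebung (powStep 0 (v.coeff 0) (v.shift 1))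

theorem map_pDeriv (f : B →+* B') (v : WittVector p B) :
    map f (pDeriv v) = pDeriv (map f v) := by
  rw [pDeriv, pDeriv, map_sub, map_verschiebung, map_powStep, map_shift, map_coeff]

theorem map_pDeriv_iterate (f : B →+* B') (v : WittVector p B) (m : ℕ) :
    map f (pDeriv^[m] v) = pDeriv^[m] (map f v) :=
  Function.Semiconj.iterate_right (map_pDeriv f) m v

theorem truncate_pDeriv {n : ℕ} {v v' : WittVector p B}
    (h : truncate (n + 1) v = truncate (n + 1) v') :
    truncate n (pDeriv v) = truncate n (pDeriv v') := by
  have h0 : v.coeff 0 = v'.coeff 0 := truncate_eq_iff.1 h 0 n.succ_pos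
  have h1 := truncate_shift_one h
  rw [pDeriv, pDeriv, map_sub, map_sub, h1, h0, truncate_eq_of_le n.le_succ
    (truncate_succ_verschiebung (truncate_powStep h1 0 (v'.coeff 0)))]

theorem coeff_pDeriv_sub {n : ℕ} {v v' : WittVector p B}
    (h : truncate (n + 1) v = truncate (n + 1) v') :
    (pDeriv v).coeff n - v.coeff (n + 1) = (pDeriv v').coeff n - v'.coeff (n + 1) := by
  have h0 : v.coeff 0 = v'.coeff 0 := truncate_eq_iff.1 h 0 n.succ_pos
  have h1 := truncate_shift_one h
  have h2 := coeff_sub_sub_coeff h1 (truncate_succ_verschiebung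
    (truncate_powStep h1 0 (v'.coeff 0)))
  rw [shift_coeff, shift_coeff, add_comm 1 n] at h2
  rw [pDeriv, pDeriv, h0, h2]

/-- Each application of `pDeriv` lowers the index by one and changes the leading component only by a
function of the earlier ones; these changes telescope. -/
theorem coeff_pDeriv_iterate_sub {n : ℕ} (m : ℕ) {v v' : WittVector p B}
    (h : truncate (n + m) v = truncate (n + m) v') :
    (pDeriv^[m] v).coeff n - v.coeff (n + m) = (pDeriv^[m] v').coeff n - v'.coeff (n + m) := by
  induction m generalizing v v' with
  | zero => simp
  | succ m ih =>
    have h1 := ih (truncate_pDeriv h)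
    have h2 := coeff_pDeriv_sub h
    simp only [Function.iterate_succ_apply]
    rw [← add_assoc]
    linear_combination h1 + h2

/-- The coordinates `v, δ v, δ² v, …` (at the constant coefficient) of a Witt vector. -/
noncomputable def jetCoord (v : WittVector p B) (i : ℕ) : B := (pDeriv^[i] v).coeff 0

theorem map_jetCoord (f : B →+* B') (v : WittVector p B) (i : ℕ) :
    f (jetCoord v i) = jetCoord (map f v) i := by
  rw [jetCoord, jetCoord, ← map_pDeriv_iterate, map_coeff]

/-- `w ^ (p ^ ν) = [w₀ ^ (p ^ ν)] + p ^ ν V (powTail ν w)`. -/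
noncomputable def powTail : ℕ → WittVector p B → WittVector p B
  | 0, w => w.shift 1
  | ν + 1, w => powStep ν (w.coeff 0 ^ p ^ ν) (powTail ν w)

theorem map_powTail (f : B →+* B') (ν : ℕ) (w : WittVector p B) :
    map f (powTail ν w) = powTail ν (map f w) := by
  induction ν with
  | zero => rfl
  | succ ν ih => rw [powTail, powTail, map_powStep, ih, map_pow, map_coeff]

theorem truncate_powTail {n : ℕ} (ν : ℕ) {w w' : WittVector p B}
    (h : truncate (n + 1) w = truncate (n + 1) w') :
    truncate n (powTail ν w) = truncate n (powTail ν w') := by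
  have h0 : w.coeff 0 = w'.coeff 0 := truncate_eq_iff.1 h 0 n.succ_pos
  induction ν with
  | zero => exact truncate_shift_one h
  | succ ν ih => rw [powTail, powTail, h0, truncate_powStep ih]

/-- The coordinates on Witt vectors in which the `p ^ ν`-th power map becomes a Frobenius. -/
noncomputable def powCoord (ν : ℕ) (c : ℕ → B) (w : WittVector p B) : ℕ → B
  | 0 => w.coeff 0
  | i + 1 => (powTail ν w).coeff i - c i

theorem map_powCoord (f : B →+* B') (ν : ℕ) (c : ℕ → B) (w : WittVector p B) (i : ℕ) :
    f (powCoord ν c w i) = powCoord ν (f ∘ c) (map f w) i := by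
  cases i with
  | zero => rfl
  | succ i => rw [powCoord, powCoord, map_sub, ← map_powTail, map_coeff, Function.comp_apply]

/-- A map on Witt vectors is triangular with leading coefficients `u` if, for fixed
`w₀, …, wₙ`, its `(n + 1)`-st component is affine in `wₙ₊₁` with slope `u w₀ n`. -/
structure IsTriangular (u : B → ℕ → B) (T : WittVector p B → ℕ → B) : Prop where
  zero : ∀ w, T w 0 = w.coeff 0
  succ : ∀ {n w w'}, truncate (n + 1) w = truncate (n + 1) w' →
    T w (n + 1) - u (w.coeff 0) n * w.coeff (n + 1) =
      T w' (n + 1) - u (w'.coeff 0) n * w'.coeff (n + 1)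

namespace IsTriangular

variable {u : B → ℕ → B} {T : WittVector p B → ℕ → B}

theorem congr (hT : IsTriangular u T) {n : ℕ} {w w' : WittVector p B}
    (h : truncate (n + 1) w = truncate (n + 1) w') : T w n = T w' n := by
  have h' := truncate_eq_iff.1 h
  cases n with
  | zero => rw [hT.zero, hT.zero, h' 0 one_pos]
  | succ n =>
    have h1 := hT.succ (truncate_eq_of_le n.succ.le_succ h)
    rw [h' 0 (by omega), h' (n + 1) (by omega)] at h1
    exact sub_left_injective h1

/-- Injectivity of a triangular map with unit slopes: the components are recovered one by one. -/
theorem truncate_eq (hT : IsTriangular u T) {n : ℕ} {w w' : WittVector p B}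
    (hu : ∀ m, IsUnit (u (w.coeff 0) m)) (h : ∀ i < n, T w i = T w' i) :
    truncate n w = truncate n w' := by
  induction n with
  | zero => exact truncate_eq_iff.2 fun i hi => by omega
  | succ n ih =>
    have h1 := ih fun i hi => h i (by omega)
    refine truncate_eq_iff.2 fun i hi => ?_
    rcases Nat.lt_succ_iff_lt_or_eq.1 hi with hi | rfl
    · exact truncate_eq_iff.1 h1 i hi
    · cases i with
      | zero => simpa only [hT.zero] using h 0 one_pos
      | succ i =>
        have h2 := hT.succ h1
        rw [h _ (by omega), ← truncate_eq_iff.1 h1 0 i.succ_pos] at h2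
        exact (hu i).mul_left_cancel (sub_right_injective h2)

theorem exists_eq (hT : IsTriangular u T) {z : ℕ → B} (hu : ∀ m, IsUnit (u (z 0) m)) :
    ∃ w, T w = z := by
  have h : ∀ n, ∃ w, ∀ i < n + 1, T w i = z i := by
    intro n
    induction n with
    | zero =>
      refine ⟨WittVector.mk p fun _ => z 0, fun i hi => ?_⟩
      obtain rfl : i = 0 := by omega
      rw [hT.zero, coeff_mk]
    | succ n ih =>
      obtain ⟨w, hw⟩ := ih
      have h0 : w.coeff 0 = z 0 := by rw [← hT.zero, hw 0 n.succ_pos]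
      obtain ⟨v, hv⟩ := hu n
      -- The affine equation for component `n + 1` is solved with the inverse slope; what happens at
      -- higher indices is irrelevant.
      let w' : WittVector p B := WittVector.mk p fun i => if i < n + 1 then w.coeff i else
        w.coeff i + (↑v⁻¹ : B) * (z (n + 1) - T w (n + 1))
      have h1 : truncate (n + 1) w' = truncate (n + 1) w :=
        truncate_eq_iff.2 fun i hi => by simp only [w', coeff_mk, if_pos hi]
      refine ⟨w', fun i hi => ?_⟩
      rcases Nat.lt_succ_iff_lt_or_eq.1 hi with hi | rfl
      · rw [← hw i hi]
        exact hT.congr (truncate_eq_of_le (by omega) h1)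
      · have h2 := hT.succ h1
        have h3 : w'.coeff (n + 1) = w.coeff (n + 1) + (↑v⁻¹ : B) * (z (n + 1) - T w (n + 1)) := by
          simp [w', coeff_mk]
        rw [h3, truncate_eq_iff.1 h1 0 n.succ_pos, h0, ← hv] at h2
        linear_combination h2 + (z (n + 1) - T w (n + 1)) * v.mul_inv
  choose w hw using h
  have h0 : ∀ n, (w n).coeff 0 = z 0 := fun n => by rw [← hT.zero, hw n 0 n.succ_pos]
  -- The approximate solutions agree on common indices by injectivity, so their diagonal is an exact
  -- solution.
  refine ⟨WittVector.mk p fun i => (w i).coeff i, funext fun n => ?_⟩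
  rw [← hw n n n.lt_succ_self]
  refine hT.congr (truncate_eq_iff.2 fun i hi => ?_)
  rw [coeff_mk]
  refine truncate_eq_iff.1 (hT.truncate_eq (n := i + 1) ?_ fun j hj => ?_) i i.lt_succ_self
  · simpa only [h0] using hu
  · rw [hw i j hj, hw n j (by omega)]

end IsTriangular

theorem isTriangular_jetCoord :
    IsTriangular (fun _ _ => 1) (jetCoord : WittVector p B → ℕ → B) where
  zero _ := rfl
  succ {n w w'} h := by
    rw [← zero_add (n + 1)] at h
    simpa [jetCoord] using coeff_pDeriv_iterate_sub (n := 0) (n + 1) h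

theorem jetCoord_zero (i : ℕ) : jetCoord (0 : WittVector p B) i = 0 := by
  have h : shift (0 : WittVector p B) 1 = 0 := by ext; simp [shift_coeff]
  have h0 : pDeriv (0 : WittVector p B) = 0 := by
    simp only [pDeriv, powStep, h]
    simp
  rw [jetCoord, Function.iterate_fixed h0, zero_coeff]

theorem jetCoord_eq_zero_iff {v : WittVector p B} {n : ℕ} :
    (∀ i < n, jetCoord v i = 0) ↔ ∀ i < n, v.coeff i = 0 := by
  constructor
  · intro h
    have h1 := isTriangular_jetCoord.truncate_eq (w := v) (w' := 0) (n := n)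
      (fun _ => isUnit_one) (fun i hi => by rw [h i hi, jetCoord_zero])
    exact fun i hi => by rw [truncate_eq_iff.1 h1 i hi, zero_coeff]
  · intro h i hi
    rw [← jetCoord_zero (p := p) i]
    refine isTriangular_jetCoord.congr (truncate_eq_iff.2 fun j hj => ?_)
    rw [h j (by omega), zero_coeff]

section CharP

variable [CharP B p]

/-- This justifies the formula for `pDeriv`: `p` may be a zero divisor in `W(B)`, so `δ v` is not
definable as a quotient. It is the case `ν = 0` of `teichmuller_add_pow`. -/
theorem frobenius_eq_pow_add (h2 : p ≠ 2) (v : WittVector p B) :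
    frobenius v = v ^ p + (p : WittVector p B) * pDeriv v := by
  have h := teichmuller_add_pow h2 0 (v.coeff 0) (v.shift 1)
  rw [pow_zero, one_mul, ← eq_teichmuller_add_verschiebung] at h
  rw [h, pDeriv]
  conv_lhs => rw [eq_teichmuller_add_verschiebung v, map_add, frobenius_verschiebung,
    frobenius_teichmuller]
  ring

/-- In characteristic `p` one has `p x = V F x`, and `F` acts componentwise. -/
theorem truncate_succ_p_mul {n : ℕ} {x y : WittVector p B} (h : truncate n x = truncate n y) :
    truncate (n + 1) ((p : WittVector p B) * x) = truncate (n + 1) ((p : WittVector p B) * y) := by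
  rw [mul_comm, ← verschiebung_frobenius, mul_comm, ← verschiebung_frobenius]
  refine truncate_succ_verschiebung ?_
  rw [truncate_eq_iff] at *
  intro i hi
  rw [coeff_frobenius_charP, coeff_frobenius_charP, h i hi]

/-- Only the linear term of `powStep` sees `ζ_n` at index `n`; the factor `p` delays all others by
one index. -/
theorem coeff_powStep_sub {n : ℕ} {ζ ζ' : WittVector p B} (h : truncate n ζ = truncate n ζ')
    (ν : ℕ) (y : B) :
    (powStep ν y ζ).coeff n - (y ^ (p * (p - 1))) ^ p ^ n * ζ.coeff n =
      (powStep ν y ζ').coeff n - (y ^ (p * (p - 1))) ^ p ^ n * ζ'.coeff n := by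
  rw [← coeff_teichmuller_mul, ← coeff_teichmuller_mul]
  refine coeff_add_sub_coeff (by rw [map_mul, map_mul, h]) (truncate_succ_p_mul ?_)
  simp only [map_mul, map_sum, map_pow, h]

theorem coeff_powTail_sub {n : ℕ} (ν : ℕ) {w w' : WittVector p B}
    (h : truncate (n + 1) w = truncate (n + 1) w') :
    (powTail ν w).coeff n - powTailLead p (w.coeff 0) n ν * w.coeff (n + 1) =
      (powTail ν w').coeff n - powTailLead p (w'.coeff 0) n ν * w'.coeff (n + 1) := by
  have h0 : w.coeff 0 = w'.coeff 0 := truncate_eq_iff.1 h 0 n.succ_pos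
  induction ν with
  | zero => simp [powTail, powTailLead, shift_coeff, add_comm 1]
  | succ ν ih =>
    have h1 := coeff_powStep_sub (truncate_powTail ν h) ν (w'.coeff 0 ^ p ^ ν)
    rw [h0] at ih
    simp only [powTail, powTailLead, h0]
    linear_combination h1 + ((w'.coeff 0 ^ p ^ ν) ^ (p * (p - 1))) ^ p ^ n * ih

theorem isTriangular_powCoord (ν : ℕ) (c : ℕ → B) :
    IsTriangular (fun x n => powTailLead p x n ν)
      (powCoord ν c : WittVector p B → ℕ → B) where
  zero _ := rfl
  succ {n w w'} h := by
    simp only [powCoord]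
    linear_combination coeff_powTail_sub ν h

theorem pow_prime_pow_eq (h2 : p ≠ 2) (ν : ℕ) (w : WittVector p B) :
    w ^ p ^ ν = teichmuller p (w.coeff 0 ^ p ^ ν) +
      verschiebung (powTail ν w * (p : WittVector p B) ^ ν) := by
  have hc : ∀ (m : ℕ) (x : WittVector p B),
      verschiebung (x * (p : WittVector p B) ^ m) =
        (p : WittVector p B) ^ m * verschiebung x := fun m x => by
    have h := natCast_mul_verschiebung (p ^ m) x
    push_cast at h
    rw [h, mul_comm]
  induction ν with
  | zero => simpa [powTail] using eq_teichmuller_add_verschiebung w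
  | succ ν ih =>
    rw [pow_succ, pow_mul, ih, hc, hc, teichmuller_add_pow h2, ← pow_mul, powTail]

theorem coeff_pow_prime_pow_zero (h2 : p ≠ 2) (ν : ℕ) (w : WittVector p B) :
    (w ^ p ^ ν).coeff 0 = w.coeff 0 ^ p ^ ν := by
  rw [pow_prime_pow_eq h2, teichmuller_add_verschiebung_coeff_zero]

theorem coeff_pow_prime_pow_eq_zero (h2 : p ≠ 2) {ν i : ℕ} (hi : i < ν) (w : WittVector p B) :
    (w ^ p ^ ν).coeff (i + 1) = 0 := by
  rw [pow_prime_pow_eq h2, teichmuller_add_verschiebung_coeff_succ,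
    mul_pow_charP_coeff_zero _ hi]

theorem coeff_pow_prime_pow_add (h2 : p ≠ 2) (ν i : ℕ) (w : WittVector p B) :
    (w ^ p ^ ν).coeff (i + ν + 1) = (powTail ν w).coeff i ^ p ^ ν := by
  rw [pow_prime_pow_eq h2, teichmuller_add_verschiebung_coeff_succ, mul_pow_charP_coeff_succ]

end CharP

end Coordinates

end WittVector

noncomputable section

namespace PJet

open WittVector

/-! ### Jet points as Witt vectors. -/

section Points

variable {p : ℕ} [hp : Fact p.Prime] {B B' : Type*} [CommRing B] [CommRing B']

/-- The evaluation of `δ`-polynomials at a sequence of values of `x, x', x'', …`. -/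
def jetEval (ι : AlgebraicClosure (ZMod p) →+* B) (b : ℕ → B) : DeltaPoly p →+* B :=
  MvPolynomial.eval₂Hom (ι.comp constantCoeff) b

/-- The evaluation of `δ`-polynomials at a Witt vector. -/
def wittEval (ι : AlgebraicClosure (ZMod p) →+* B) (w : WittVector p B) :
    DeltaPoly p →+* WittVector p B :=
  MvPolynomial.eval₂Hom (WittVector.map ι) fun i => pDeriv^[i] w

theorem coeff_zero_wittEval (ι : AlgebraicClosure (ZMod p) →+* B) (w : WittVector p B)
    (F : DeltaPoly p) : (wittEval ι w F).coeff 0 = jetEval ι (jetCoord w) F := by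
  have h : (constantCoeff : WittVector p B →+* B).comp (wittEval ι w) =
      jetEval ι (jetCoord w) := by
    refine MvPolynomial.ringHom_ext (fun r => ?_) fun i => ?_
    · simp only [wittEval, jetEval, RingHom.comp_apply, MvPolynomial.coe_eval₂Hom,
        MvPolynomial.eval₂_C]
      rfl
    · simp only [wittEval, jetEval, RingHom.comp_apply, MvPolynomial.coe_eval₂Hom,
        MvPolynomial.eval₂_X]
      rfl
  exact RingHom.congr_fun h F

theorem map_wittEval (ι : AlgebraicClosure (ZMod p) →+* B) (h : B →+* B') (w : WittVector p B)
    (F : DeltaPoly p) :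
    WittVector.map h (wittEval ι w F) = wittEval (h.comp ι) (WittVector.map h w) F := by
  have h : (WittVector.map h).comp (wittEval ι w) =
      wittEval (h.comp ι) (WittVector.map h w) := by
    refine MvPolynomial.ringHom_ext (fun r => ?_) fun i => ?_
    · simp only [wittEval, RingHom.comp_apply, MvPolynomial.coe_eval₂Hom,
        MvPolynomial.eval₂_C]
      rfl
    · simp only [wittEval, RingHom.comp_apply, MvPolynomial.coe_eval₂Hom,
        MvPolynomial.eval₂_X, map_pDeriv_iterate]
  exact RingHom.congr_fun h F

theorem wittEval_phi (h2 : p ≠ 2) [CharP B p] (ι : AlgebraicClosure (ZMod p) →+* B)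
    (w : WittVector p B) (F : DeltaPoly p) :
    wittEval ι w (phi p F) = frobenius (wittEval ι w F) := by
  have h : (wittEval ι w).comp (phi p) = frobenius.comp (wittEval ι w) := by
    refine MvPolynomial.ringHom_ext (fun r => ?_) fun i => ?_
    · simp only [wittEval, phi, RingHom.comp_apply, MvPolynomial.coe_eval₂Hom,
        MvPolynomial.eval₂_C]
      exact map_frobenius ι r
    · simp only [wittEval, phi, RingHom.comp_apply, MvPolynomial.coe_eval₂Hom,
        MvPolynomial.eval₂_X, MvPolynomial.eval₂_add, MvPolynomial.eval₂_mul,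
        MvPolynomial.eval₂_pow, MvPolynomial.eval₂_natCast, frobenius_eq_pow_add h2,
        Function.iterate_succ_apply']
  exact RingHom.congr_fun h F

theorem wittEval_delta_of_isDomain (h2 : p ≠ 2) [CharP B p] [IsDomain B]
    (ι : AlgebraicClosure (ZMod p) →+* B) (w : WittVector p B) (F : DeltaPoly p) :
    wittEval ι w (delta p F) = pDeriv (wittEval ι w F) := by
  have h := wittEval_phi h2 ι w F
  rw [phi_eq, frobenius_eq_pow_add h2, map_add, map_pow, map_mul, map_natCast] at h
  exact mul_left_cancel₀ (WittVector.p_nonzero p B) (add_left_cancel h)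

/-- Over a domain of characteristic `p`, the factor `p` can be cancelled in `W(B)`. The general case
specializes the Witt vector with indeterminate components, by naturality of `pDeriv`. -/
theorem wittEval_delta (h2 : p ≠ 2) (ι : AlgebraicClosure (ZMod p) →+* B) (w : WittVector p B)
    (F : DeltaPoly p) : wittEval ι w (delta p F) = pDeriv (wittEval ι w F) := by
  let C := MvPolynomial ℕ (AlgebraicClosure (ZMod p))
  let w₀ : WittVector p C := WittVector.mk p fun i => MvPolynomial.X i
  let h : C →+* B := MvPolynomial.eval₂Hom ι w.coeff
  have h₁ : h.comp MvPolynomial.C = ι := RingHom.ext fun r => MvPolynomial.eval₂_C _ _ _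
  have h₃ : WittVector.map h w₀ = w := by
    ext i
    rw [map_coeff, WittVector.coeff_mk]
    exact MvPolynomial.eval₂_X _ _ _
  have h₄ := congrArg (WittVector.map h)
    (wittEval_delta_of_isDomain h2 (MvPolynomial.C : _ →+* C) w₀ F)
  rwa [map_wittEval, map_pDeriv, map_wittEval, h₁, h₃] at h₄

theorem jetEval_delta_iterate (h2 : p ≠ 2) (ι : AlgebraicClosure (ZMod p) →+* B)
    (w : WittVector p B) (F : DeltaPoly p) (i : ℕ) :
    jetEval ι (jetCoord w) ((delta p)^[i] F) = jetCoord (wittEval ι w F) i := by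
  rw [← coeff_zero_wittEval, jetCoord,
    (show Function.Semiconj (wittEval ι w) (delta p) pDeriv from
      wittEval_delta h2 ι w).iterate_right i F]

/-- The sequence `b` is a point of the `p`-jet space of order `n` of `Spec R[x]/(f)`. -/
def IsJetPoint (ι : AlgebraicClosure (ZMod p) →+* B) (f : Polynomial (UnrRing p)) (n : ℕ)
    (b : ℕ → B) : Prop :=
  ∀ i ≤ n, jetEval ι b ((delta p)^[i] (toDelta p f)) = 0

theorem wittEval_muPoly (ι : AlgebraicClosure (ZMod p) →+* B) (w : WittVector p B) (ν : ℕ)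
    (a : UnrRing p) :
    wittEval ι w (toDelta p (muPoly p ν a)) = w ^ p ^ ν - WittVector.map ι a := by
  simp only [toDelta, muPoly, map_sub, map_pow, Polynomial.aeval_X, Polynomial.aeval_C,
    MvPolynomial.algebraMap_eq]
  simp only [wittEval, MvPolynomial.coe_eval₂Hom, MvPolynomial.eval₂_C, MvPolynomial.eval₂_X,
    Function.iterate_zero, id]

/-- Evaluation turns `δ^i f` into the `i`-th jet coordinate of `w^(p^ν) - a`. By triangularity, the
first jet coordinates of a Witt vector vanish together with its first components. -/
theorem isJetPoint_muPoly_iff_coeff (h2 : p ≠ 2) (ι : AlgebraicClosure (ZMod p) →+* B)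
    (w : WittVector p B) (n ν : ℕ) (a : UnrRing p) :
    IsJetPoint ι (muPoly p ν a) n (jetCoord w) ↔
      ∀ i ≤ n, (w ^ p ^ ν).coeff i = ι (a.coeff i) := by
  have h : IsJetPoint ι (muPoly p ν a) n (jetCoord w) ↔
      ∀ i < n + 1, jetCoord (w ^ p ^ ν - WittVector.map ι a) i = 0 := by
    simp only [IsJetPoint, jetEval_delta_iterate h2, wittEval_muPoly, Nat.lt_succ_iff]
  rw [h, jetCoord_eq_zero_iff, ← le_coeff_eq_iff_le_sub_coeff_eq_zero]
  simp only [map_coeff, Nat.lt_succ_iff]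

/-- The jet coordinates `b` and the coordinates `z` adapted to the `p ^ ν`-th power map belong to
the same Witt vector. -/
def JetCorr (p : ℕ) [Fact p.Prime] (ν : ℕ) (c b z : ℕ → B) : Prop :=
  ∃ w : WittVector p B, jetCoord w = b ∧ powCoord ν c w = z

namespace JetCorr

variable {ν : ℕ} {c b b' z z' : ℕ → B}

theorem map (h : JetCorr p ν c b z) (g : B →+* B') : JetCorr p ν (g ∘ c) (g ∘ b) (g ∘ z) := by
  obtain ⟨w, rfl, rfl⟩ := h
  exact ⟨WittVector.map g w, funext fun i => (map_jetCoord g w i).symm,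
    funext fun i => (map_powCoord g ν c w i).symm⟩

theorem exists_right (ν : ℕ) (c b : ℕ → B) : ∃ z, JetCorr p ν c b z := by
  obtain ⟨w, hw⟩ := (isTriangular_jetCoord (p := p)).exists_eq (z := b) fun _ => isUnit_one
  exact ⟨_, w, hw, rfl⟩

variable [CharP B p]

theorem exists_left (ν : ℕ) (c : ℕ → B) (hz : IsUnit (z 0)) : ∃ b, JetCorr p ν c b z := by
  obtain ⟨w, hw⟩ := (isTriangular_powCoord (p := p) ν c).exists_eq (z := z)
    fun m => isUnit_powTailLead p hz m ν
  exact ⟨_, w, rfl, hw⟩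

theorem congr_right (h : JetCorr p ν c b z) (h' : JetCorr p ν c b' z') {n : ℕ}
    (hb : ∀ i ≤ n, b i = b' i) : ∀ i ≤ n, z i = z' i := by
  obtain ⟨w, rfl, rfl⟩ := h
  obtain ⟨w', rfl, rfl⟩ := h'
  have hw := isTriangular_jetCoord.truncate_eq (n := n + 1) (fun _ => isUnit_one)
    fun i hi => hb i (Nat.lt_succ_iff.1 hi)
  exact fun i hi => (isTriangular_powCoord ν c).congr (truncate_eq_of_le (by omega) hw)

theorem congr_left (h : JetCorr p ν c b z) (h' : JetCorr p ν c b' z') (hu : IsUnit (z 0))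
    {n : ℕ} (hz : ∀ i ≤ n, z i = z' i) : ∀ i ≤ n, b i = b' i := by
  obtain ⟨w, rfl, rfl⟩ := h
  obtain ⟨w', rfl, rfl⟩ := h'
  have hw := (isTriangular_powCoord ν c).truncate_eq (n := n + 1)
    (fun m => isUnit_powTailLead p hu m ν) fun i hi => hz i (Nat.lt_succ_iff.1 hi)
  exact fun i hi => isTriangular_jetCoord.congr (truncate_eq_of_le (by omega) hw)

/-- Additivity of the `p^ν`-th power in characteristic `p` absorbs the constants `a_(i+ν+1)` into
the shift by `γ_i`; at the indices `1, …, ν` both sides vanish. -/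
theorem isJetPoint_iff (h2 : p ≠ 2) {ι : AlgebraicClosure (ZMod p) →+* B} {a : UnrRing p}
    (ha0 : a.coeff 0 = 1) (ha : ∀ i < ν, a.coeff (i + 1) = 0)
    {γ : ℕ → AlgebraicClosure (ZMod p)} (hγ : ∀ i, γ i ^ p ^ ν = a.coeff (i + ν + 1))
    (h : JetCorr p ν (ι ∘ γ) b z) (n : ℕ) :
    IsJetPoint ι (muPoly p ν a) n b ↔
      z 0 ^ p ^ ν = 1 ∧ ∀ i, i + ν + 1 ≤ n → z (i + 1) ^ p ^ ν = 0 := by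
  obtain ⟨w, rfl, rfl⟩ := h
  have hz : ∀ i, powCoord ν (ι ∘ γ) w (i + 1) ^ p ^ ν = 0 ↔
      (w ^ p ^ ν).coeff (i + ν + 1) = ι (a.coeff (i + ν + 1)) := fun i => by
    rw [powCoord, sub_pow_char_pow, coeff_pow_prime_pow_add h2, Function.comp_apply, ← map_pow,
      hγ, sub_eq_zero]
  rw [isJetPoint_muPoly_iff_coeff h2]
  constructor
  · intro H
    refine ⟨?_, fun i hi => (hz i).2 (H _ hi)⟩
    have := H 0 n.zero_le
    rwa [coeff_pow_prime_pow_zero h2, ha0, map_one] at this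
  · rintro ⟨H0, H⟩ (_ | i) hi
    · rw [coeff_pow_prime_pow_zero h2, ha0, map_one]
      exact H0
    · by_cases hν : i < ν
      · rw [coeff_pow_prime_pow_eq_zero h2 hν, ha i hν, map_zero]
      · obtain ⟨j, rfl⟩ := Nat.exists_eq_add_of_le' (not_lt.1 hν)
        exact (hz j).1 (H j hi)

end JetCorr

theorem coeff_eq_zero_of_isJetPoint (h2 : p ≠ 2) [CharP B p] [Nontrivial B]
    {ι : AlgebraicClosure (ZMod p) →+* B} {a : UnrRing p} {n ν : ℕ} (hn : ν ≤ n) {b : ℕ → B}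
    (h : IsJetPoint ι (muPoly p ν a) n b) : ∀ i < ν, a.coeff (i + 1) = 0 := by
  intro i hi
  obtain ⟨w, rfl⟩ := (isTriangular_jetCoord (p := p)).exists_eq (z := b) fun _ => isUnit_one
  have h1 := (isJetPoint_muPoly_iff_coeff h2 ι w n ν a).1 h (i + 1) (by omega)
  rw [coeff_pow_prime_pow_eq_zero h2 hi] at h1
  exact ι.injective (by rw [← h1, map_zero])

end Points

theorem mem_principalUnits_iff {p : ℕ} [Fact p.Prime] {a : UnrRing p} {m : ℕ} :
    a ∈ principalUnits p (m + 1) ↔ a.coeff 0 = 1 ∧ ∀ i < m, a.coeff (i + 1) = 0 := by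
  have h : a ∈ principalUnits p (m + 1) ↔
      a - 1 ∈ Ideal.span {(p : UnrRing p) ^ (m + 1)} := by
    rw [Ideal.mem_span_singleton', principalUnits, Set.mem_ofPred_eq]
    refine exists_congr fun b => ?_
    rw [eq_sub_iff_add_eq, eq_comm, mul_comm, add_comm]
  rw [h, mem_span_p_pow_iff_le_coeff_eq_zero, ← le_coeff_eq_iff_le_sub_coeff_eq_zero]
  constructor
  · intro h
    refine ⟨by simpa using h 0 m.succ_pos, fun i hi => ?_⟩
    rw [h (i + 1) (by omega), one_coeff_eq_of_pos _ _ _ i.succ_pos]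
  · rintro ⟨h0, h⟩ (_ | i) hi
    · simpa using h0
    · rw [h i (by omega), one_coeff_eq_of_pos _ _ _ i.succ_pos]

/-! ### The order of iterated `δ`-derivatives. -/

section Delta

variable {p : ℕ} [hp : Fact p.Prime]

theorem exists_jetIncl_eq_iff {n : ℕ} {F : DeltaPoly p} :
    (∃ g, jetIncl p n g = F) ↔ (F.vars : Set ℕ) ⊆ Set.Iic n := by
  have hr : Set.range (fun i : Fin (n + 1) => (i : ℕ)) = Set.Iic n := by
    ext i
    exact ⟨fun ⟨j, hj⟩ => hj ▸ Nat.lt_succ_iff.1 j.2, fun h => ⟨⟨i, Nat.lt_succ_iff.2 h⟩, rfl⟩⟩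
  constructor
  · rintro ⟨g, rfl⟩ i hi
    classical
    have h := MvPolynomial.vars_rename (fun i : Fin (n + 1) => (i : ℕ)) g hi
    obtain ⟨j, -, rfl⟩ := Finset.mem_image.1 h
    exact Nat.lt_succ_iff.1 j.2
  · intro h
    exact MvPolynomial.exists_rename_eq_of_vars_subset_range F _ Fin.val_injective (hr ▸ h)

theorem exists_jetIncl_phi {n : ℕ} (g : JetPoly p n) :
    ∃ g', jetIncl p (n + 1) g' = phi p (jetIncl p n g) := by
  induction g using MvPolynomial.induction_on with
  | C r => exact ⟨MvPolynomial.C (frobenius r), by simp [jetIncl, phi]⟩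
  | add g g' h h' =>
    obtain ⟨u, hu⟩ := h
    obtain ⟨v, hv⟩ := h'
    exact ⟨u + v, by rw [map_add, map_add, map_add, hu, hv]⟩
  | mul_X g i h =>
    obtain ⟨u, hu⟩ := h
    refine ⟨u * (MvPolynomial.X i.castSucc ^ p + (p : JetPoly p (n + 1)) *
      MvPolynomial.X i.succ), ?_⟩
    rw [map_mul, map_mul, map_mul, hu]
    simp [jetIncl, phi]

/-- The variables of `δ g` are those of `p δ g = φ g - g^p`, because `p` is a nonzero element of the
domain `R`. -/
theorem exists_jetIncl_delta {n : ℕ} (g : JetPoly p n) :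
    ∃ g', jetIncl p (n + 1) g' = delta p (jetIncl p n g) := by
  obtain ⟨g₁, h₁⟩ := exists_jetIncl_phi g
  have h := phi_eq p (jetIncl p n g)
  have h₂ : MvPolynomial.C (p : UnrRing p) * delta p (jetIncl p n g) =
      jetIncl p (n + 1) (g₁ - jetPolyMap p n.le_succ g ^ p) := by
    rw [map_sub, map_pow, jetIncl_jetPolyMap, h₁, h, map_natCast]
    ring
  rw [exists_jetIncl_eq_iff, ← MvPolynomial.vars_C_mul (p : UnrRing p) (WittVector.p_nonzero p _),
    h₂]
  exact exists_jetIncl_eq_iff.1 ⟨_, rfl⟩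

theorem exists_jetIncl_delta_iterate (f : Polynomial (UnrRing p)) {i n : ℕ} (h : i ≤ n) :
    ∃ g, jetIncl p n g = (delta p)^[i] (toDelta p f) := by
  suffices H : ∃ g, jetIncl p i g = (delta p)^[i] (toDelta p f) by
    obtain ⟨g, hg⟩ := H
    exact ⟨jetPolyMap p h g, by rw [jetIncl_jetPolyMap, hg]⟩
  clear h
  induction i with
  | zero =>
    refine ⟨Polynomial.aeval (MvPolynomial.X 0) f, ?_⟩
    rw [← Polynomial.aeval_algHom_apply]
    simp [jetIncl, toDelta]
  | succ i ih =>
    obtain ⟨g, hg⟩ := ih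
    rw [Function.iterate_succ_apply', ← hg]
    exact exists_jetIncl_delta g

end Delta

/-! ### Algebras over the residue field. -/

section Residue

variable {p : ℕ} [hp : Fact p.Prime] {B B' : Type} [CommRing B] [CommRing B']
  [Algebra (ResField p) B] [Algebra (ResField p) B']

/-- The embedding of `𝔽̄_p` in an algebra over the residue field. -/
def residueMap (p : ℕ) [Fact p.Prime] (B : Type) [CommRing B] [Algebra (ResField p) B] :
    AlgebraicClosure (ZMod p) →+* B :=
  (algebraMap (ResField p) B).comp (quotientPEquiv (p := p)).symm.toRingHom

theorem comp_residueMap (g : B →ₐ[ResField p] B') :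
    (g : B →+* B').comp (residueMap p B) = residueMap p B' := by
  ext r
  exact g.commutes _

theorem residueMap_coeff_zero [Algebra (UnrRing p) B] [IsScalarTower (UnrRing p) (ResField p) B]
    (r : UnrRing p) : residueMap p B (constantCoeff r) = algebraMap (UnrRing p) B r := by
  rw [IsScalarTower.algebraMap_apply (UnrRing p) (ResField p) B]
  change algebraMap (ResField p) B ((quotientPEquiv (p := p)).symm (constantCoeff r)) = _
  congr 1
  rw [RingEquiv.symm_apply_eq]
  exact (quotientPEquiv_mk r).symm

theorem charP_of_nontrivial [Nontrivial B] : CharP B p :=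
  charP_of_injective_ringHom (residueMap p B).injective p

theorem natCast_eq_zero_of_residue (p : ℕ) [Fact p.Prime] (B : Type) [CommRing B]
    [Algebra (ResField p) B] : (p : B) = 0 := by
  rw [← map_natCast (residueMap p B), CharP.cast_eq_zero, map_zero]

end Residue

theorem aeval_mem_subalgebra {R A σ : Type*} [CommSemiring R] [CommSemiring A] [Algebra R A]
    {S : Subalgebra R A} {x : σ → A} (h : ∀ i, x i ∈ S) (q : MvPolynomial σ R) :
    MvPolynomial.aeval x q ∈ S := by
  induction q using MvPolynomial.induction_on with
  | C r => simp
  | add q q' h₁ h₂ => rw [map_add]; exact add_mem h₁ h₂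
  | mul_X q i h₁ => rw [map_mul, MvPolynomial.aeval_X]; exact mul_mem h₁ (h i)

/-! ### Maps from jet rings to algebras over the residue field. -/

section JetRing

variable {p : ℕ} [hp : Fact p.Prime] {f : Polynomial (UnrRing p)} {n : ℕ} {B : Type} [CommRing B]
  [Algebra (ResField p) B] [Algebra (UnrRing p) B]

/-- The class of a polynomial in `𝒪ⁿ(X)`. -/
def jetMk (f : Polynomial (UnrRing p)) (n : ℕ) : JetPoly p n →ₐ[UnrRing p] JetRing p f n :=
  ((Ideal.Quotient.mkₐ (PCompletion p (JetPoly p n)) (jetIdeal p f n)).restrictScalars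
    (UnrRing p)).comp ((Algebra.ofId (JetPoly p n)
      (PCompletion p (JetPoly p n))).restrictScalars (UnrRing p))

theorem jetMk_apply (g : JetPoly p n) : jetMk f n g =
    Ideal.Quotient.mk (jetIdeal p f n) (AdicCompletion.of _ (JetPoly p n) g) := rfl

theorem jetMk_eq_zero {g : JetPoly p n} (hg : g ∈ jetGens p f n) : jetMk f n g = 0 := by
  rw [jetMk_apply, Ideal.Quotient.eq_zero_iff_mem]
  exact Ideal.subset_span ⟨g, hg, rfl⟩

/-- Completion does not change the ring modulo `p`. Hence maps to `k`-algebras, where `p = 0`, are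
determined by the images of the variables. -/
theorem exists_eq_jetMk_add (y : JetRing p f n) :
    ∃ g t, y = jetMk f n g + (p : JetRing p f n) * t := by
  obtain ⟨y, rfl⟩ := Ideal.Quotient.mk_surjective y
  let I : Ideal (JetPoly p n) := Ideal.span {(p : JetPoly p n)}
  obtain ⟨g, hg⟩ := Ideal.Quotient.mk_surjective (AdicCompletion.evalOneₐ I y)
  have h : y - AdicCompletion.of I (JetPoly p n) g ∈
      RingHom.ker (AdicCompletion.evalOneₐ I).toRingHom := by
    rw [RingHom.mem_ker, map_sub, sub_eq_zero]
    exact hg.symm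
  have h' := (AdicCompletion.ker_evalOneₐ_eq_map (I := I) (Submodule.fg_span_singleton _)).le h
  rw [Ideal.map_span, Set.image_singleton, map_natCast, Ideal.mem_span_singleton'] at h'
  obtain ⟨t, ht⟩ := h'
  refine ⟨g, Ideal.Quotient.mk _ t, ?_⟩
  rw [jetMk_apply, ← map_natCast (Ideal.Quotient.mk (jetIdeal p f n)), ← map_mul, ← map_add,
    mul_comm, ht, add_sub_cancel]

theorem exists_map_eq_aeval (g : JetRing p f n →ₐ[UnrRing p] B) (y : JetRing p f n) :
    ∃ q : JetPoly p n, g y =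
      MvPolynomial.aeval (fun i => g (jetMk f n (MvPolynomial.X i))) q := by
  obtain ⟨q, t, rfl⟩ := exists_eq_jetMk_add y
  refine ⟨q, ?_⟩
  rw [map_add, map_mul, map_natCast, natCast_eq_zero_of_residue p B, zero_mul, add_zero,
    ← AlgHom.comp_apply]
  congr 1
  ext i
  simp

theorem map_mem_of_forall_mem (g : JetRing p f n →ₐ[UnrRing p] B) {S : Subalgebra (UnrRing p) B}
    (h : ∀ i, g (jetMk f n (MvPolynomial.X i)) ∈ S) (y : JetRing p f n) : g y ∈ S := by
  obtain ⟨q, hq⟩ := exists_map_eq_aeval g y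
  rw [hq]
  exact aeval_mem_subalgebra h q

theorem jetRing_algHom_ext {g g' : JetRing p f n →ₐ[UnrRing p] B}
    (h : ∀ i, g (jetMk f n (MvPolynomial.X i)) = g' (jetMk f n (MvPolynomial.X i))) :
    g = g' := by
  ext y
  obtain ⟨q, t, rfl⟩ := exists_eq_jetMk_add y
  have hq : g.comp (jetMk f n) = g'.comp (jetMk f n) := MvPolynomial.algHom_ext h
  rw [map_add, map_add, map_mul, map_mul, map_natCast, map_natCast,
    natCast_eq_zero_of_residue p B, zero_mul, zero_mul]
  exact congrArg (· + 0) (AlgHom.congr_fun hq q)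

variable [IsScalarTower (UnrRing p) (ResField p) B]

theorem jetEval_jetIncl (b : ℕ → B) (g : JetPoly p n) :
    jetEval (residueMap p B) b (jetIncl p n g) =
      MvPolynomial.aeval (fun i : Fin (n + 1) => b i) g := by
  have h : (jetEval (residueMap p B) b).comp (jetIncl p n).toRingHom =
      (MvPolynomial.aeval (R := UnrRing p) (fun i : Fin (n + 1) => b i)).toRingHom := by
    refine MvPolynomial.ringHom_ext (fun r => ?_) fun i => ?_
    · simpa [jetEval, jetIncl] using residueMap_coeff_zero r
    · simp [jetEval, jetIncl]
  exact RingHom.congr_fun h g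

theorem isJetPoint_of_algHom (g : JetRing p f n →ₐ[UnrRing p] B) {b : ℕ → B}
    (hb : ∀ i : Fin (n + 1), g (jetMk f n (MvPolynomial.X i)) = b i) :
    IsJetPoint (residueMap p B) f n b := by
  intro i hi
  obtain ⟨q, hq⟩ := exists_jetIncl_delta_iterate f hi
  have h : g.comp (jetMk f n) = MvPolynomial.aeval (fun i : Fin (n + 1) => b i) :=
    MvPolynomial.algHom_ext fun i => by rw [AlgHom.comp_apply, hb, MvPolynomial.aeval_X]
  rw [← hq, jetEval_jetIncl, ← h, AlgHom.comp_apply, jetMk_eq_zero ⟨i, hi, hq⟩, map_zero]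

theorem exists_jetRing_algHom {b : ℕ → B} (hb : IsJetPoint (residueMap p B) f n b) :
    ∃ g : JetRing p f n →ₐ[UnrRing p] B,
      ∀ i : Fin (n + 1), g (jetMk f n (MvPolynomial.X i)) = b i := by
  let e : JetPoly p n →ₐ[UnrRing p] B := MvPolynomial.aeval fun i : Fin (n + 1) => b i
  let I : Ideal (JetPoly p n) := Ideal.span {(p : JetPoly p n)}
  have hI : ∀ q ∈ I, e q = 0 := by
    intro q hq
    obtain ⟨t, rfl⟩ := Ideal.mem_span_singleton'.1 hq
    rw [map_mul, map_natCast, natCast_eq_zero_of_residue p B, mul_zero]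
  let e' : PCompletion p (JetPoly p n) →ₐ[UnrRing p] B := (Ideal.Quotient.liftₐ I e hI).comp
    ((AdicCompletion.evalOneₐ I).restrictScalars (UnrRing p))
  have he' : ∀ q, e' (AdicCompletion.of I (JetPoly p n) q) = e q := fun q => rfl
  have hJ : ∀ y ∈ jetIdeal p f n, e' y = 0 := by
    intro y hy
    have hle : jetIdeal p f n ≤ RingHom.ker e' := by
      refine Ideal.span_le.2 ?_
      rintro _ ⟨q, ⟨i, hi, hq⟩, rfl⟩
      change e' _ = 0
      rw [he', ← jetEval_jetIncl, hq]
      exact hb i hi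
    exact hle hy
  refine ⟨Ideal.Quotient.liftₐ (jetIdeal p f n) e' hJ, fun i => ?_⟩
  change e (MvPolynomial.X i) = b i
  exact MvPolynomial.aeval_X _ _

theorem jetMap_jetMk {m n : ℕ} (h : m ≤ n) (q : JetPoly p m) :
    jetMap p f m n h (jetMk f m q) = jetMk f n (jetPolyMap p h q) := by
  rw [jetMk_apply, jetMk_apply, ← completionMap_of]
  rfl

theorem jetToInf_jetMap {m n : ℕ} (h : m ≤ n) (y : JetRing p f m) :
    jetToInf p f n (jetMap p f m n h y) = jetToInf p f m y :=
  DirectLimit.Algebra.of_f (G := JetRing p f) (f := jetMap p f) (hij := h) y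

/-- The function `x^{(i)}` on the `p`-jet space of infinite order. -/
def jetInfX (f : Polynomial (UnrRing p)) (i : ℕ) : JetRingInf p f :=
  jetToInf p f i (jetMk f i (MvPolynomial.X (Fin.last i)))

theorem jetToInf_jetMk_X (i : Fin (n + 1)) :
    jetToInf p f n (jetMk f n (MvPolynomial.X i)) = jetInfX f i := by
  have hi : (i : ℕ) ≤ n := Nat.lt_succ_iff.1 i.2
  rw [jetInfX, ← jetToInf_jetMap hi, jetMap_jetMk, jetPolyMap, MvPolynomial.rename_X]
  rfl

theorem isJetPoint_of_jetRingInf_algHom (g : JetRingInf p f →ₐ[UnrRing p] B) (n : ℕ) :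
    IsJetPoint (residueMap p B) f n fun i => g (jetInfX f i) :=
  isJetPoint_of_algHom (g.comp (jetToInf p f n)) fun i => by
    rw [AlgHom.comp_apply, jetToInf_jetMk_X]

theorem exists_jetRingInf_algHom {b : ℕ → B} (hb : ∀ n, IsJetPoint (residueMap p B) f n b) :
    ∃ g : JetRingInf p f →ₐ[UnrRing p] B, ∀ i, g (jetInfX f i) = b i := by
  choose g hg using fun n => exists_jetRing_algHom (hb n)
  have h : ∀ m n hmn x, g n (jetMap p f m n hmn x) = g m x := by
    intro m n hmn x
    refine AlgHom.congr_fun (jetRing_algHom_ext (g := (g n).comp (jetMap p f m n hmn))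
      fun i => ?_) x
    rw [AlgHom.comp_apply, jetMap_jetMk, jetPolyMap, MvPolynomial.rename_X, hg, hg]
    rfl
  exact ⟨DirectLimit.Algebra.lift (JetRing p f) (jetMap p f) B g h, fun i => hg i (Fin.last i)⟩

end JetRing

/-! ### Reductions modulo `p` and the image in the limit. -/

section Reduction

variable {p : ℕ} [hp : Fact p.Prime] {f : Polynomial (UnrRing p)} {n : ℕ} {B : Type} [CommRing B]
  [Algebra (ResField p) B] [Algebra (UnrRing p) B] [IsScalarTower (UnrRing p) (ResField p) B]

theorem exists_residue_algHom {M : Type} [CommRing M] [Algebra (UnrRing p) M]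
    (g : M →ₐ[UnrRing p] B) : ∃ g' : ResField p ⊗[UnrRing p] M →ₐ[ResField p] B,
      ∀ y, g' (1 ⊗ₜ y) = g y :=
  ⟨Algebra.TensorProduct.lift (Algebra.ofId (ResField p) B) g fun _ _ => Commute.all _ _,
    fun y => by rw [Algebra.TensorProduct.lift_tmul, map_one, one_mul]⟩

theorem jetBar_algHom_ext {g g' : JetBar p f n →ₐ[ResField p] B}
    (h : ∀ i, g (1 ⊗ₜ jetMk f n (MvPolynomial.X i)) = g' (1 ⊗ₜ jetMk f n (MvPolynomial.X i))) :
    g = g' :=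
  Algebra.TensorProduct.ext (Subsingleton.elim _ _) (jetRing_algHom_ext h)

/-- Together with `tmul_jetInfX_mem_jetTilde`, this identifies the image as the `k`-subalgebra
generated by `x, …, x^{(n)}`. -/
theorem jetTilde_le {S : Subalgebra (ResField p) (JetBarInf p f)}
    (h : ∀ i ≤ n, (1 : ResField p) ⊗ₜ jetInfX f i ∈ S) : jetTilde p f n ≤ S := by
  rintro _ ⟨x, rfl⟩
  change Algebra.TensorProduct.map (AlgHom.id (ResField p) (ResField p)) (jetToInf p f n) x ∈ S
  induction x using TensorProduct.induction_on with
  | zero => rw [map_zero]; exact zero_mem S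
  | add x y hx hy => rw [map_add]; exact add_mem hx hy
  | tmul t y =>
    rw [Algebra.TensorProduct.map_tmul, AlgHom.id_apply, ← mul_one t, ← smul_eq_mul,
      ← TensorProduct.smul_tmul']
    refine S.smul_mem ?_ t
    refine map_mem_of_forall_mem (S := S.restrictScalars (UnrRing p))
      ((Algebra.TensorProduct.includeRight : JetRingInf p f →ₐ[UnrRing p] JetBarInf p f).comp
        (jetToInf p f n)) (fun i => ?_) y
    rw [AlgHom.comp_apply, jetToInf_jetMk_X]
    exact h i (Nat.lt_succ_iff.1 i.2)

theorem tmul_jetInfX_mem_jetTilde {i : ℕ} (hi : i ≤ n) :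
    (1 : ResField p) ⊗ₜ jetInfX f i ∈ jetTilde p f n := by
  refine ⟨1 ⊗ₜ jetMk f n (MvPolynomial.X ⟨i, Nat.lt_succ_iff.2 hi⟩), ?_⟩
  change Algebra.TensorProduct.map _ _ _ = _
  rw [Algebra.TensorProduct.map_tmul, jetToInf_jetMk_X, map_one]

end Reduction

/-! ### The explicit algebras. -/

section Model

variable {p : ℕ} [hp : Fact p.Prime] {n ν r : ℕ}

/-- The classes of the variables in `BarModel p n ν r`, extended by zero. -/
def barX (p : ℕ) [Fact p.Prime] (n ν r i : ℕ) : BarModel p n ν r :=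
  if h : i < n + 1 then Ideal.Quotient.mk _ (MvPolynomial.X ⟨i, h⟩) else 0

theorem barX_val (i : Fin (n + 1)) :
    barX p n ν r i = Ideal.Quotient.mk _ (MvPolynomial.X i) := dif_pos i.2

theorem barX_zero_pow : barX p n ν r 0 ^ p ^ ν = 1 := by
  rw [← sub_eq_zero, show barX p n ν r 0 = _ from barX_val (0 : Fin (n + 1)), ← map_pow,
    ← map_one (Ideal.Quotient.mk _), ← map_sub, Ideal.Quotient.eq_zero_iff_mem]
  exact Ideal.subset_span (Or.inl rfl)

/-- The extension by zero satisfies the equations beyond index `n`, so for `r = n` the sequence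
gives a jet point of every order. -/
theorem barX_succ_pow {i : ℕ} (hi : i + 1 ≤ r ∨ n < i + 1) :
    barX p n ν r (i + 1) ^ p ^ ν = 0 := by
  by_cases h : i + 1 < n + 1
  · rw [show barX p n ν r (i + 1) = _ from barX_val (⟨i + 1, h⟩ : Fin (n + 1)), ← map_pow,
      Ideal.Quotient.eq_zero_iff_mem]
    exact Ideal.subset_span (Or.inr ⟨⟨i + 1, h⟩, Nat.succ_pos i, by simp; omega, rfl⟩)
  · rw [barX, dif_neg h, zero_pow (pow_ne_zero _ hp.out.ne_zero)]

theorem isUnit_barX_zero : IsUnit (barX p n ν r 0) :=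
  IsUnit.of_pow_eq_one barX_zero_pow (pow_ne_zero _ hp.out.ne_zero)

theorem exists_barModel_algHom {B : Type} [CommRing B] [Algebra (ResField p) B] {y : ℕ → B}
    (h0 : y 0 ^ p ^ ν = 1) (h : ∀ i, i + 1 ≤ n → i + 1 ≤ r → y (i + 1) ^ p ^ ν = 0) :
    ∃ g : BarModel p n ν r →ₐ[ResField p] B,
      (∀ i ≤ n, g (barX p n ν r i) = y i) ∧
      ∀ S : Subalgebra (ResField p) B, (∀ i ≤ n, y i ∈ S) → g.range ≤ S := by
  let e : MvPolynomial (Fin (n + 1)) (ResField p) →ₐ[ResField p] B :=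
    MvPolynomial.aeval fun i => y i
  have he : ∀ i, e (MvPolynomial.X i) = y i := MvPolynomial.aeval_X _
  let I : Ideal (MvPolynomial (Fin (n + 1)) (ResField p)) :=
    Ideal.span ({MvPolynomial.X 0 ^ p ^ ν - 1} ∪
      {g : MvPolynomial (Fin (n + 1)) (ResField p) |
        ∃ i : Fin (n + 1), 1 ≤ (i : ℕ) ∧ (i : ℕ) ≤ r ∧ g = MvPolynomial.X i ^ p ^ ν})
  have hI : I ≤ RingHom.ker e := by
    refine Ideal.span_le.2 ?_
    rintro _ (rfl | ⟨⟨i, hi⟩, hi1, hir, rfl⟩)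
    · change e _ = 0
      rw [map_sub, map_pow, he, map_one]
      exact sub_eq_zero.2 h0
    · change e _ = 0
      rw [map_pow, he]
      obtain ⟨j, rfl⟩ := Nat.exists_eq_add_of_le' hi1
      exact h j (Nat.lt_succ_iff.1 hi) hir
  refine ⟨Ideal.Quotient.liftₐ I e fun q hq => hI hq, fun i hi => ?_, fun S hS => ?_⟩
  · rw [show barX p n ν r i = _ from barX_val (⟨i, Nat.lt_succ_iff.2 hi⟩ : Fin (n + 1))]
    exact he _
  · rintro _ ⟨q, rfl⟩
    obtain ⟨q, rfl⟩ := Ideal.Quotient.mk_surjective q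
    exact aeval_mem_subalgebra (fun i : Fin (n + 1) => hS i (Nat.lt_succ_iff.1 i.2)) q

theorem barModel_algHom_ext {B : Type} [CommRing B] [Algebra (ResField p) B]
    {g g' : BarModel p n ν r →ₐ[ResField p] B}
    (h : ∀ i ≤ n, g (barX p n ν r i) = g' (barX p n ν r i)) : g = g' := by
  refine Ideal.Quotient.algHom_ext _ (MvPolynomial.algHom_ext fun i => ?_)
  have := h i (Nat.lt_succ_iff.1 i.2)
  rwa [barX_val] at this

instance : Nontrivial (ResField p) :=
  (quotientPEquiv (p := p) (k := AlgebraicClosure (ZMod p))).toEquiv.nontrivial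

instance : Nontrivial (BarModel p n ν r) := by
  obtain ⟨g, -⟩ := exists_barModel_algHom (p := p) (n := n) (ν := ν) (r := r)
    (y := fun i => if i = 0 then (1 : ResField p) else 0) (by simp) fun i _ _ => by
      simp [hp.out.ne_zero]
  exact g.toRingHom.domain_nontrivial

theorem nonempty_tildeModel_algEquiv (n ν : ℕ) :
    Nonempty (BarModel p n ν n ≃ₐ[ResField p] TildeModel p n ν) := by
  have : CharP (ResField p) p := charP_of_nontrivial
  refine ⟨Ideal.quotientEquivAlgOfEq _ ?_⟩
  rw [sub_pow_char_pow, one_pow]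
  congr 2
  ext g
  exact exists_congr fun i => and_congr_right fun _ =>
    ⟨fun h => h.2, fun h => ⟨Nat.lt_succ_iff.1 i.2, h⟩⟩

theorem nonempty_barModel_zero_algEquiv (n ν : ℕ) :
    Nonempty (BarModel p n ν 0 ≃ₐ[ResField p] MvPolynomial (Fin (n + 1)) (ResField p) ⧸
      Ideal.span {(MvPolynomial.X 0 ^ p ^ ν - 1 :
        MvPolynomial (Fin (n + 1)) (ResField p))}) := by
  refine ⟨Ideal.quotientEquivAlgOfEq _ ?_⟩
  congr 1
  refine Set.union_eq_left.2 ?_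
  rintro g ⟨i, h1, h2, -⟩
  omega

end Model

/-! ### Comparison of the universal points. -/

section Main

variable {p : ℕ} [hp : Fact p.Prime]

theorem JetCorr.map_algHom {B B' : Type} [CommRing B] [CommRing B'] [Algebra (ResField p) B]
    [Algebra (ResField p) B'] {ν : ℕ} {γ : ℕ → AlgebraicClosure (ZMod p)} {b z : ℕ → B}
    (h : JetCorr p ν (residueMap p B ∘ γ) b z) (g : B →ₐ[ResField p] B') :
    JetCorr p ν (residueMap p B' ∘ γ) (g ∘ b) (g ∘ z) := by
  rw [← comp_residueMap g]
  exact h.map (g : B →+* B')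

/-- The coordinate change can be carried out inside `S`; its result agrees with `z` up to index `n`
by uniqueness. -/
theorem JetCorr.mem_subalgebra {A : Type} [CommRing A] [Algebra (ResField p) A] [CharP A p]
    {ν n : ℕ} {γ : ℕ → AlgebraicClosure (ZMod p)} {b z : ℕ → A}
    (h : JetCorr p ν (residueMap p A ∘ γ) b z) {S : Subalgebra (ResField p) A}
    (hb : ∀ i ≤ n, b i ∈ S) : ∀ i ≤ n, z i ∈ S := by
  let b' : ℕ → S := fun i => if h : i ≤ n then ⟨b i, hb i h⟩ else 0
  obtain ⟨z', hz'⟩ := JetCorr.exists_right (p := p) ν (residueMap p S ∘ γ) b'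
  have h' := (hz'.map_algHom S.val).congr_right h (n := n) fun i hi => by simp [b', hi]
  exact fun i hi => h' i hi ▸ (z' i).2

theorem exists_pow_eq_coeff (a : UnrRing p) (ν : ℕ) :
    ∃ γ : ℕ → AlgebraicClosure (ZMod p), ∀ i, γ i ^ p ^ ν = a.coeff (i + ν + 1) := by
  choose γ hγ using fun i => IsAlgClosed.exists_pow_nat_eq (a.coeff (i + ν + 1))
    (pow_pos hp.out.pos ν)
  exact ⟨γ, hγ⟩

/-- If the image were nonzero, the reduced limit ring would be a nonzero ring carrying a jet point
of order `ν`, which forces `a_1 = … = a_ν = 0`. -/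
theorem subsingleton_jetTilde (h2 : p ≠ 2) {n ν : ℕ} {a : UnrRing p}
    (ha1 : a ∈ principalUnits p 1) (ha : a ∉ principalUnits p (ν + 1)) :
    Subsingleton (jetTilde p (muPoly p ν a) n) := by
  by_contra hn
  have : Nontrivial (jetTilde p (muPoly p ν a) n) := not_subsingleton_iff_nontrivial.1 hn
  have : Nontrivial (JetBarInf p (muPoly p ν a)) :=
    Subtype.val_injective.nontrivial (α := jetTilde p (muPoly p ν a) n)
  have : CharP (JetBarInf p (muPoly p ν a)) p := charP_of_nontrivial
  have h := isJetPoint_of_jetRingInf_algHom (f := muPoly p ν a)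
    (Algebra.TensorProduct.includeRight :
      JetRingInf p (muPoly p ν a) →ₐ[UnrRing p] JetBarInf p (muPoly p ν a)) ν
  exact ha (mem_principalUnits_iff.2 ⟨(mem_principalUnits_iff.1 ha1).1,
    coeff_eq_zero_of_isJetPoint h2 le_rfl h⟩)

/-- The map `g` sends the variables to the jet coordinates `b` attached to the generators of the
model, and `g'` sends those generators to the power coordinates `y` of the universal jet point `β`.
Uniqueness in both coordinate changes makes them mutually inverse. -/
theorem nonempty_jetBar_algEquiv (h2 : p ≠ 2) (n : ℕ) {ν : ℕ} {a : UnrRing p}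
    (ha : a ∈ principalUnits p (ν + 1)) :
    Nonempty (JetBar p (muPoly p ν a) n ≃ₐ[ResField p] BarModel p n ν (n - ν)) := by
  obtain ⟨ha0, ha⟩ := mem_principalUnits_iff.1 ha
  obtain ⟨γ, hγ⟩ := exists_pow_eq_coeff a ν
  let A := JetBar p (muPoly p ν a) n
  let M := BarModel p n ν (n - ν)
  have hM := charP_of_nontrivial (p := p) (B := M)
  obtain ⟨b, hb⟩ := JetCorr.exists_left (p := p) ν (residueMap p M ∘ γ)
    (z := barX p n ν (n - ν)) isUnit_barX_zero
  have hbJ : IsJetPoint (residueMap p M) (muPoly p ν a) n b :=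
    (hb.isJetPoint_iff h2 ha0 ha hγ n).2
      ⟨barX_zero_pow, fun i hi => barX_succ_pow (Or.inl (by omega))⟩
  obtain ⟨g₀, hg₀⟩ := exists_jetRing_algHom hbJ
  obtain ⟨g, hg⟩ := exists_residue_algHom (p := p) (B := M) g₀
  -- The map to the nonzero model shows that `A` is nonzero, hence of characteristic `p`.
  have : Nontrivial A := g.toRingHom.domain_nontrivial
  have hA : CharP A p := charP_of_nontrivial
  let β : ℕ → A := fun i => if h : i < n + 1 then
    1 ⊗ₜ jetMk (muPoly p ν a) n (MvPolynomial.X ⟨i, h⟩) else 0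
  have hβ : ∀ i : Fin (n + 1),
      1 ⊗ₜ jetMk (muPoly p ν a) n (MvPolynomial.X i) = β i := fun i => by
    simp only [β, dif_pos i.2]
  have hβJ : IsJetPoint (residueMap p A) (muPoly p ν a) n β :=
    isJetPoint_of_algHom (Algebra.TensorProduct.includeRight :
      JetRing p (muPoly p ν a) n →ₐ[UnrRing p] A) hβ
  obtain ⟨y, hy⟩ := JetCorr.exists_right (p := p) ν (residueMap p A ∘ γ) β
  obtain ⟨hy0, hy1⟩ := (hy.isJetPoint_iff h2 ha0 ha hγ n).1 hβJ
  obtain ⟨g', hg', -⟩ := exists_barModel_algHom (n := n) (r := n - ν) hy0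
    fun i _ hi => hy1 i (by omega)
  have hgβ : ∀ i ≤ n, g (β i) = b i := fun i hi => by
    rw [← hβ ⟨i, Nat.lt_succ_iff.2 hi⟩, hg, hg₀]
  have h₁ := hy.map_algHom (B' := M) g
  have h₂ := hb.map_algHom (B' := A) g'
  refine ⟨AlgEquiv.ofAlgHom g g' (barModel_algHom_ext (p := p) (B := M) fun i hi => ?_)
    (jetBar_algHom_ext (p := p) (B := A) fun i => ?_)⟩
  · rw [AlgHom.comp_apply, hg' i hi]
    exact h₁.congr_right hb hgβ i hi
  · rw [hβ, AlgHom.comp_apply, hgβ _ (Nat.lt_succ_iff.1 i.2)]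
    exact h₂.congr_left hy (isUnit_barX_zero.map (g' : M →+* A)) hg' _ (Nat.lt_succ_iff.1 i.2)

theorem nonempty_jetTilde_algEquiv (h2 : p ≠ 2) (n : ℕ) {ν : ℕ} {a : UnrRing p}
    (ha : a ∈ principalUnits p (ν + 1)) :
    Nonempty (jetTilde p (muPoly p ν a) n ≃ₐ[ResField p] BarModel p n ν n) := by
  obtain ⟨ha0, ha⟩ := mem_principalUnits_iff.1 ha
  obtain ⟨γ, hγ⟩ := exists_pow_eq_coeff a ν
  let A := JetBarInf p (muPoly p ν a)
  let M := BarModel p n ν n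
  have hM := charP_of_nontrivial (p := p) (B := M)
  obtain ⟨b, hb⟩ := JetCorr.exists_left (p := p) ν (residueMap p M ∘ γ)
    (z := barX p n ν n) isUnit_barX_zero
  have hbJ : ∀ m, IsJetPoint (residueMap p M) (muPoly p ν a) m b := fun m =>
    (hb.isJetPoint_iff h2 ha0 ha hγ m).2
      ⟨barX_zero_pow, fun i _ => barX_succ_pow (le_or_gt (i + 1) n)⟩
  obtain ⟨g₀, hg₀⟩ := exists_jetRingInf_algHom hbJ
  obtain ⟨g, hg⟩ := exists_residue_algHom (p := p) (B := M) g₀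
  have : Nontrivial A := g.toRingHom.domain_nontrivial
  have hA : CharP A p := charP_of_nontrivial
  let β : ℕ → A := fun i => 1 ⊗ₜ jetInfX (muPoly p ν a) i
  have hβJ : ∀ m, IsJetPoint (residueMap p A) (muPoly p ν a) m β :=
    isJetPoint_of_jetRingInf_algHom (Algebra.TensorProduct.includeRight :
      JetRingInf p (muPoly p ν a) →ₐ[UnrRing p] A)
  obtain ⟨y, hy⟩ := JetCorr.exists_right (p := p) ν (residueMap p A ∘ γ) β
  have hyJ := fun m => (hy.isJetPoint_iff h2 ha0 ha hγ m).1 (hβJ m)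
  -- The relation on `y (i + 1)` first appears at order `i + ν + 1`; such orders are all available
  -- in the limit, so every variable up to `n` gets one.
  obtain ⟨g', hg', hg'S⟩ := exists_barModel_algHom (n := n) (r := n) (hyJ 0).1
    fun i _ _ => (hyJ (i + ν + 1)).2 i le_rfl
  have hgβ : ∀ i, g (β i) = b i := fun i => (hg _).trans (hg₀ i)
  have h₁ := hy.map_algHom (B' := M) g
  have h₂ := hb.map_algHom (B' := A) g'
  have hgg' : g.comp g' = AlgHom.id _ _ := barModel_algHom_ext (p := p) (B := M) fun i hi => by
    rw [AlgHom.comp_apply, hg' i hi]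
    exact h₁.congr_right hb (fun i _ => hgβ i) i hi
  have hinj : Function.Injective g' :=
    Function.LeftInverse.injective (g := g) fun x => AlgHom.congr_fun hgg' x
  -- Up to index `n`, the power coordinates `y` lie in the algebra generated by `β`, and conversely
  -- `β i = g' (b i)`.
  have hrange : g'.range = jetTilde p (muPoly p ν a) n := by
    refine le_antisymm (hg'S _ ?_) (jetTilde_le fun i hi => ?_)
    · exact hy.mem_subalgebra fun i hi => tmul_jetInfX_mem_jetTilde hi
    · refine ⟨b i, ?_⟩
      exact h₂.congr_left hy (isUnit_barX_zero.map (g' : M →+* A)) hg' i hi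
  exact ⟨((AlgEquiv.ofInjective g' hinj).trans (Subalgebra.equivOfEq _ _ hrange)).symm⟩

theorem one_mem_principalUnits (m : ℕ) : (1 : UnrRing p) ∈ principalUnits p m :=
  ⟨0, by rw [mul_zero, add_zero]⟩

end Main

end PJet

end

theorem theorem5p6 (p : ℕ) [Fact p.Prime] (hp : p ≠ 2) (n ν : ℕ) (hn : 1 ≤ n) (hν : 1 ≤ ν)
    (a : PJet.UnrRing p) (ha : a ∈ PJet.principalUnits p 1) :
    (a ∉ PJet.principalUnits p (ν + 1) →
      Subsingleton (PJet.jetTilde p (PJet.muPoly p ν a) n)) ∧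
    (a ∈ PJet.principalUnits p (ν + 1) →
      (Nonempty (PJet.jetTilde p (PJet.muPoly p ν a) n ≃ₐ[PJet.ResField p]
          PJet.jetTilde p (PJet.muPoly p ν 1) n) ∧
        Nonempty (PJet.jetTilde p (PJet.muPoly p ν 1) n ≃ₐ[PJet.ResField p]
          PJet.TildeModel p n ν)) ∧
      Nonempty (PJet.JetBar p (PJet.muPoly p ν a) n ≃ₐ[PJet.ResField p]
        PJet.JetBar p (PJet.muPoly p ν 1) n) ∧
      (n ≤ ν → Nonempty (PJet.JetBar p (PJet.muPoly p ν 1) n ≃ₐ[PJet.ResField p]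
        MvPolynomial (Fin (n + 1)) (PJet.ResField p) ⧸
          Ideal.span {(MvPolynomial.X 0 ^ p ^ ν - 1 :
            MvPolynomial (Fin (n + 1)) (PJet.ResField p))})) ∧
      (ν + 1 ≤ n → Nonempty (PJet.JetBar p (PJet.muPoly p ν 1) n ≃ₐ[PJet.ResField p]
        PJet.BarModel p n ν (n - ν)))) := by
  refine ⟨PJet.subsingleton_jetTilde hp ha, fun haν => ?_⟩
  have h1 := PJet.one_mem_principalUnits (p := p) (ν + 1)
  obtain ⟨t⟩ := PJet.nonempty_jetTilde_algEquiv hp n haν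
  obtain ⟨t₁⟩ := PJet.nonempty_jetTilde_algEquiv hp n h1
  obtain ⟨e⟩ := PJet.nonempty_jetBar_algEquiv hp n haν
  obtain ⟨e₁⟩ := PJet.nonempty_jetBar_algEquiv hp n h1
  obtain ⟨m⟩ := PJet.nonempty_tildeModel_algEquiv (p := p) n ν
  refine ⟨⟨⟨t.trans t₁.symm⟩, ⟨t₁.trans m⟩⟩, ⟨e.trans e₁.symm⟩, fun h => ?_, fun _ => ⟨e₁⟩⟩
  obtain ⟨m₀⟩ := PJet.nonempty_barModel_zero_algEquiv (p := p) n ν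
  rw [Nat.sub_eq_zero_of_le h] at e₁
  exact ⟨e₁.trans m₀⟩
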